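/- **Conventions.** Concatenation of finite sequences is written $\times$. A *partial group* $\mathcal P$ consists of a set $\mathcal P_1$, sets $\mathcal P_n\subseteq \mathcal P_1^{\,n}$ $(n\ge 2)$, maps $\nabla_n:\mathcal P_n\to\mathcal P_1$ $(n\ge1$, $\nabla_1=\mathrm{id})$, an element $1\in\mathcal P_1$ and a map $\pi\mapsto\pi^{-1}$ on $\mathcal P_1$ such that: omitting the first or the last entry maps $\mathcal P_n$ to $\mathcal P_{n-1}$ $(n>1)$; $\mathrm{id}_{\mathcal P_p}\times\nabla_q\times\mathrm{id}_{\mathcal P_r}$ maps $\mathcal P_{p+q+r}$ to $\mathcal P_{p+1+r}$ and $\nabla_{p+1+r}\circ(\mathrm{id}\times\nabla_q\times\mathrm{id})=\nabla_{p+q+r}$ on $\mathcal P_{p+q+r}$ $(p,r\ge0,\ q>0)$; inserting $1$ at any place maps $\mathcal P_n$ to $\mathcal P_{n+1}$; $\nabla_2(1,\pi)=\nabla_2(\pi,1)=\pi$; for $\boldsymbol\pi=(\pi_1,\dots,\pi_n)\in\mathcal P_n$ and $\boldsymbol\pi^{-1}:=(\pi_n^{-1},\dots,\pi_1^{-1})$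 both $\boldsymbol\pi\times\boldsymbol\pi^{-1}$ and $\boldsymbol\pi^{-1}\times\boldsymbol\pi$ lie in $\mathcal P_{2n}$; and $\nabla_2(\pi,\pi^{-1})=1=\nabla_2(\pi^{-1},\pi)$. A *map of partial groups* $\phi:\mathcal Q\to\mathcal P$ is a map $\phi:\mathcal Q_1\to\mathcal P_1$ with $\phi^n(\mathcal Q_n)\subseteq\mathcal P_n$ and $\nabla_n\circ\phi^n=\phi\circ\nabla_n$ on $\mathcal Q_n$ for all $n\ge1$, where $\phi^n$ applies $\phi$ entrywise. This gives the category $\mathbf{PG}$. Let $\mathcal F$ be a partial group. An *$\mathcal F$-set* is a nonempty set $X$ with subsets $X\mathcal F_n\subseteq X\times\mathcal F_n$ and maps $\lhd_n:X\mathcal F_n\to X$ $(n>0$; $X\mathcal F_0:=X$, $\lhd_0:=\mathrm{id})$ such that: $(x|\gamma_1,\dots,\gamma_{n+1})\in X\mathcal F_{n+1}$ implies $(x|\gamma_1,\dots,\gamma_n)\in X\mathcal F_n$; $\lhd_p\times\mathrm{id}$ maps $X\mathcal F_{p+q}$ to $X\mathcal F_q$ and $\lhd_q\circ(\lhd_p\times\mathrm{id})=\lhd_{p+q}$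 there $(p,q\ge 1)$; $\mathrm{id}\times\nabla_q\times\mathrm{id}$ maps $X\mathcal F_{p+q+r}$ to $X\mathcal F_{p+1+r}$ and is compatible with $\lhd$ $(p,r\ge0,\ q\geq 1)$; inserting $1$ at any place of $\boldsymbol\gamma$ maps $X\mathcal F_n$ to $X\mathcal F_{n+1}$ $(n\ge0)$; $\lhd_1(x|1)=x$; and $(x|\boldsymbol\gamma)\in X\mathcal F_n$ implies $(x|\boldsymbol\gamma\times\boldsymbol\gamma^{-1})\in X\mathcal F_{2n}$. A *map of $\mathcal F$-sets* is a map $f:X\to Y$ such that $(x|\boldsymbol\gamma)\in X\mathcal F_n$ implies $(f(x)|\boldsymbol\gamma)\in Y\mathcal F_n$ and $\lhd_n(f(x)|\boldsymbol\gamma)=f(\lhd_n(x|\boldsymbol\gamma))$, for all $n>0$. An *$\mathcal F$-partial group* is a partial group $\mathcal H$ with an $\mathcal F$-set structure $(\mathcal H_r\mathcal F_n,\lhd_{r|n})_{n>0}$ on each $\mathcal H_r$ $(r>0)$ such that the following are maps of $\mathcal F$-sets: omission of the first or of the last entry $\mathcal H_r\to\mathcal H_{r-1}$ $(r>1)$;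 $\mathrm{id}\times\nabla_q\times\mathrm{id}:\mathcal H_{p+q+r}\to\mathcal H_{p+1+r}$ $(p,r\ge0,\ q>0)$; insertion of $1$ at any place $\mathcal H_r\to\mathcal H_{r+1}$; and $\boldsymbol\eta\mapsto\boldsymbol\eta\times\boldsymbol\eta^{-1}$, $\boldsymbol\eta\mapsto\boldsymbol\eta^{-1}\times\boldsymbol\eta$, $\mathcal H_r\to\mathcal H_{2r}$; and such that $(1|\boldsymbol\gamma)\in\mathcal H_1\mathcal F_n$ and $\lhd(1|\boldsymbol\gamma)=1$ for all $\boldsymbol\gamma\in\mathcal F_n$. A *map of $\mathcal F$-partial groups* $f:\mathcal H\to\mathcal P$ is a map of partial groups such that $f^n:\mathcal H_n\to\mathcal P_n$ is a map of $\mathcal F$-sets for all $n>0$. This gives the category $\mathbf{PG}_{\mathcal F}$. For a map $\phi:\mathcal F\to\mathcal P$ of partial groups, $\mathcal P^\phi$ denotes the $\mathcal F$-partial group $\mathcal P$ in which $(\boldsymbol\pi|\boldsymbol\gamma)\in\mathcal P_r\times\mathcal F_n$ belongs to $\mathcal P^\phi_r\mathcal F_n$ if and only if $$\boldsymbol\rho_1\times\cdots\times\boldsymbol\rho_r\in\mathcal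 P_{(2n+1)r},\qquad \boldsymbol\rho_j:=\phi^n(\boldsymbol\gamma)^{-1}\times(\pi_j)\times\phi^n(\boldsymbol\gamma),$$ and then $\lhd(\boldsymbol\pi|\boldsymbol\gamma)=(\nabla_{2n+1}(\boldsymbol\rho_j))_{1\le j\le r}$. The assignment $\phi\mapsto\mathcal P^\phi$ is a functor $\Phi:(\mathcal F\downarrow\mathbf{PG})\to\mathbf{PG}_{\mathcal F}$, which sends a morphism $\chi$ to the map $\chi$. For an $\mathcal F$-partial group $\mathcal H$, the *semidirect product* $\mathcal F\ltimes\mathcal H$ is the following partial group. Its elements are the pairs $\gamma\ltimes\eta:=(\gamma,\eta)\in\mathcal F_1\times\mathcal H_1$ with $(\eta|\gamma^{-1})\in\mathcal H_1\mathcal F_1$. A sequence $\boldsymbol\alpha=(\gamma_i\ltimes\eta_i)_{1\le i\le n}$ of elements belongs to $(\mathcal F\ltimes\mathcal H)_n$ if and only if $(\eta_j|\gamma_{j+1},\dots,\gamma_n)\in\mathcal H_1\mathcal F_{n-j}$ for $1\le j<n$ and $(A(\boldsymbol\alpha)|\gamma_n^{-1},\dots,\gamma_1^{-1})\in\mathcal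 H_n\mathcal F_n$, where $$A(\boldsymbol\alpha):=(\lhd(\eta_1|\gamma_2,\dots,\gamma_n),\ \lhd(\eta_2|\gamma_3,\dots,\gamma_n),\ \dots,\ \lhd(\eta_{n-1}|\gamma_n),\ \eta_n).$$ Its operations are $\nabla_n(\boldsymbol\alpha)=\nabla_n(\gamma_1,\dots,\gamma_n)\ltimes\nabla_n(A(\boldsymbol\alpha))$, its unit is $1\ltimes1$, and $(\gamma\ltimes\eta)^{-1}=\gamma^{-1}\ltimes\lhd(\eta|\gamma^{-1})^{-1}$. **Theorem.** Let $\mathcal F$ be a partial group and $\mathcal H$ an $\mathcal F$-partial group. Then $\iota(\gamma)=\gamma\ltimes1$ defines a map $\iota:\mathcal F\to\mathcal F\ltimes\mathcal H$ of partial groups, $h(\eta)=1\ltimes\eta$ defines a map $h:\mathcal H\to(\mathcal F\ltimes\mathcal H)^\iota$ of $\mathcal F$-partial groups, and $(\iota,h)$ is a universal arrow from $\mathcal H$ to the functor $\Phi$. In other words, for every map $\phi:\mathcal F\to\mathcal P$ of partial groups and every map $f:\mathcal H\to\mathcal P^\phi$ of $\mathcal F$-partial groups there is a unique map $\psi:\mathcal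 F\ltimes\mathcal H\to\mathcal P$ of partial groups such that $\psi\circ\iota=\phi$ and $\psi\circ h=f$. Moreover, for every $\gamma\ltimes\eta\in(\mathcal F\ltimes\mathcal H)_1$ one has $(\phi(\gamma),f(\eta))\in\mathcal P_2$ and $\psi(\gamma\ltimes\eta)=\nabla_2(\phi(\gamma),f(\eta))$. -/

import Mathlib

universe u v

open CategoryTheory

/-- A partial group. Sequences `(π₁, …, πₙ)` are lists, and the family of partial operations
`∇ₙ : 𝒫ₙ → 𝒫₁` (`n ≥ 1`) is one partial function `prod` on lists: `𝒫ₙ` is the set of lists of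
length `n` in the domain of `prod`. There are only sequences of length `n ≥ 1`, and
`∇₁` is the identity of `𝒫₁ = carrier`. -/
structure PartialGroup : Type (u + 1) where
  carrier : Type u
  prod : List carrier →. carrier
  one : carrier
  inv : carrier → carrier
  not_dom_nil : ¬ (prod []).Dom
  prod_singleton : ∀ a, prod [a] = Part.some a
  /-- Sequences of length `n > 1` may be shortened on the left … -/
  dom_tail : ∀ a w, w ≠ [] → (prod (a :: w)).Dom → (prod w).Dom
  /-- … and on the right. -/
  dom_init : ∀ w a, w ≠ [] → (prod (w ++ [a])).Dom → (prod w).Dom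
  /-- A non-empty factor may be replaced by its product: if `(l, v, r) ∈ 𝒫_{p+q+r}`, `q > 0`, then
  `(l, ∇v, r) ∈ 𝒫_{p+1+r}` has the same product. -/
  prod_contract : ∀ l v r y, v ≠ [] → y ∈ prod v → (prod (l ++ v ++ r)).Dom →
    prod (l ++ [y] ++ r) = prod (l ++ v ++ r)
  /-- Units may be inserted. -/
  dom_insert_one : ∀ l r, (prod (l ++ r)).Dom → (prod (l ++ [one] ++ r)).Dom
  /-- The unit laws. -/
  prod_one_left : ∀ a, prod [one, a] = Part.some a
  prod_one_right : ∀ a, prod [a, one] = Part.some a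
  /-- If `π ∈ 𝒫ₙ`, then `π × π⁻¹` and `π⁻¹ × π` belong to `𝒫₂ₙ`. -/
  dom_mul_inv : ∀ w, (prod w).Dom → (prod (w ++ (w.map inv).reverse)).Dom
  dom_inv_mul : ∀ w, (prod w).Dom → (prod ((w.map inv).reverse ++ w)).Dom
  /-- The inverse laws. -/
  prod_mul_inv : ∀ a, prod [a, inv a] = Part.some one
  prod_inv_mul : ∀ a, prod [inv a, a] = Part.some one

namespace PartialGroup

instance : CoeSort PartialGroup.{u} (Type u) := ⟨carrier⟩

/-- The inverse sequence `(πₙ⁻¹, …, π₁⁻¹)`. -/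
def invW (P : PartialGroup.{u}) (w : List P) : List P := (w.map P.inv).reverse

/-- A map of partial groups: `φⁿ(𝒬ₙ) ⊆ 𝒫ₙ` and `∇(φⁿ(π)) = φ(∇(π))` for all `π ∈ 𝒬ₙ`, `n ≥ 1`. -/
@[ext]
structure Hom (Q P : PartialGroup.{u}) : Type u where
  toFun : Q → P
  map_prod : ∀ w z, z ∈ Q.prod w → toFun z ∈ P.prod (w.map toFun)

instance (Q P : PartialGroup.{u}) : CoeFun (Hom Q P) (fun _ => Q → P) := ⟨Hom.toFun⟩

/-- The category `PG` of partial groups. -/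
instance : Category PartialGroup.{u} where
  Hom := Hom
  id P := ⟨id, fun w z h => by simpa using h⟩
  comp f g := ⟨fun x => g (f x), fun w z h => by
    simpa [Function.comp_def] using g.map_prod _ _ (f.map_prod _ _ h)⟩

section basic

variable {P : PartialGroup.{u}}

/-- `z` is the product of `w`, where the product of the empty sequence is `1` (auxiliary). -/
def Val (P : PartialGroup.{u}) (w : List P) (z : P) : Prop :=
  (w = [] ∧ z = P.one) ∨ z ∈ P.prod w

theorem val_of_mem {w : List P} {z : P} (h : z ∈ P.prod w) : P.Val w z := Or.inr h

theorem val_nil : P.Val [] P.one := Or.inl ⟨rfl, rfl⟩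

theorem mem_of_val {w : List P} {z : P} (hw : w ≠ []) (h : P.Val w z) : z ∈ P.prod w := by
  rcases h with h | h
  · exact absurd h.1 hw
  · exact h

theorem dom_of_val {w : List P} {z : P} (hw : w ≠ []) (h : P.Val w z) : (P.prod w).Dom :=
  Part.dom_iff_mem.2 ⟨z, mem_of_val hw h⟩

theorem ne_nil_of_mem {w : List P} {z : P} (h : z ∈ P.prod w) : w ≠ [] := by
  rintro rfl
  exact P.not_dom_nil (Part.dom_iff_mem.2 ⟨z, h⟩)

theorem ne_nil_of_dom {w : List P} (h : (P.prod w).Dom) : w ≠ [] := by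
  rintro rfl
  exact P.not_dom_nil h

theorem val_unique {w : List P} {y z : P} (h : P.Val w y) (h' : P.Val w z) : y = z := by
  by_cases hw : w = []
  · subst hw
    rcases h with h | h
    · rcases h' with h' | h'
      · rw [h.2, h'.2]
      · exact absurd rfl (ne_nil_of_mem h')
    · exact absurd rfl (ne_nil_of_mem h)
  · exact Part.mem_unique (mem_of_val hw h) (mem_of_val hw h')

theorem val_singleton (a : P) : P.Val [a] a :=
  Or.inr (by rw [P.prod_singleton]; exact Part.mem_some a)

theorem val_singleton_iff {a z : P} : P.Val [a] z ↔ z = a :=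
  ⟨fun h => val_unique h (val_singleton a), fun h => h ▸ val_singleton a⟩

theorem exists_val_of_dom {w : List P} (h : (P.prod w).Dom) : ∃ z, P.Val w z :=
  ⟨_, val_of_mem (Part.get_mem h)⟩

theorem val_insert_one {l r : List P} {z : P} (h : P.Val (l ++ r) z) :
    P.Val (l ++ [P.one] ++ r) z := by
  by_cases hw : l ++ r = []
  · obtain ⟨rfl, rfl⟩ := List.append_eq_nil_iff.1 hw
    rw [val_unique h val_nil]
    exact val_singleton _
  · have hd := P.dom_insert_one l r (dom_of_val hw h)
    rcases r with _ | ⟨a, r⟩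
    · rcases List.eq_nil_or_concat l with rfl | ⟨l, a, rfl⟩
      · simp at hw
      · have := P.prod_contract l [a, P.one] [] a (by simp)
          (by rw [P.prod_one_right]; exact Part.mem_some a) (by simpa using hd)
        refine Or.inr ?_
        have h2 := mem_of_val hw h
        simp only [List.append_nil, List.append_assoc, List.cons_append, List.nil_append,
          List.concat_eq_append] at this h2 ⊢
        rwa [← this]
    · have := P.prod_contract l [P.one, a] r a (by simp)
          (by rw [P.prod_one_left]; exact Part.mem_some a) (by simpa using hd)
      refine Or.inr ?_
      have h2 := mem_of_val hw h
      simp only [List.append_assoc, List.cons_append, List.nil_append] at this h2 ⊢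
      rwa [← this]

theorem val_contract {l v r : List P} {y z : P} (hv : P.Val v y) (h : P.Val (l ++ v ++ r) z) :
    P.Val (l ++ [y] ++ r) z := by
  by_cases hw : v = []
  · subst hw
    rw [val_unique hv val_nil]
    exact val_insert_one (by simpa using h)
  · have hne : l ++ v ++ r ≠ [] := by simp [hw]
    refine Or.inr ?_
    rw [P.prod_contract l v r y hw (mem_of_val hw hv) (dom_of_val hne h)]
    exact mem_of_val hne h

theorem val_right {l r : List P} {z : P} (h : P.Val (l ++ r) z) : ∃ y, P.Val r y := by
  induction l generalizing z with
  | nil => exact ⟨z, h⟩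
  | cons a l ih =>
    by_cases hw : l ++ r = []
    · obtain ⟨rfl, rfl⟩ := List.append_eq_nil_iff.1 hw
      exact ⟨_, val_nil⟩
    · obtain ⟨y, hy⟩ := exists_val_of_dom
        (P.dom_tail a (l ++ r) hw (dom_of_val (by simp) h))
      exact ih hy

theorem val_left {l r : List P} {z : P} (h : P.Val (l ++ r) z) : ∃ y, P.Val l y := by
  induction r using List.reverseRecOn generalizing z with
  | nil => exact ⟨z, by simpa using h⟩
  | append_singleton r a ih =>
    rw [← List.append_assoc] at h
    by_cases hw : l ++ r = []
    · obtain ⟨rfl, rfl⟩ := List.append_eq_nil_iff.1 hw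
      exact ⟨_, val_nil⟩
    · obtain ⟨y, hy⟩ := exists_val_of_dom (P.dom_init (l ++ r) a hw (dom_of_val (by simp) h))
      exact ih hy

theorem val_mid {l v r : List P} {z : P} (h : P.Val (l ++ v ++ r) z) : ∃ y, P.Val v y := by
  obtain ⟨y, hy⟩ := val_left h
  exact val_right hy

theorem val_delete_one {l r : List P} {z : P} (h : P.Val (l ++ [P.one] ++ r) z) :
    P.Val (l ++ r) z := by
  by_cases hw : l ++ r = []
  · obtain ⟨rfl, rfl⟩ := List.append_eq_nil_iff.1 hw
    rw [val_unique h (val_singleton P.one)]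
    exact val_nil
  · rcases r with _ | ⟨a, r⟩
    · rcases List.eq_nil_or_concat l with rfl | ⟨l, a, rfl⟩
      · simp at hw
      · have := val_contract (l := l) (v := [a, P.one]) (r := []) (y := a) (z := z)
          (Or.inr (by rw [P.prod_one_right]; exact Part.mem_some a)) (by simpa using h)
        simpa using this
    · have := val_contract (l := l) (v := [P.one, a]) (r := r) (y := a) (z := z)
          (Or.inr (by rw [P.prod_one_left]; exact Part.mem_some a)) (by simpa using h)
      simpa using this

theorem invW_append (v w : List P) : P.invW (v ++ w) = P.invW w ++ P.invW v := by
  simp [invW]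

theorem invW_cons (a : P) (w : List P) : P.invW (a :: w) = P.invW w ++ [P.inv a] := by
  simp [invW]

theorem invW_nil : P.invW [] = [] := rfl

theorem invW_singleton (a : P) : P.invW [a] = [P.inv a] := rfl

theorem invW_length (w : List P) : (P.invW w).length = w.length := by simp [invW]

theorem invW_ne_nil {w : List P} (h : w ≠ []) : P.invW w ≠ [] := by simpa [invW] using h

theorem inv_unique {a b : P} (h : P.Val [a, b] P.one) : b = P.inv a := by
  obtain ⟨y, hy⟩ := exists_val_of_dom (P.dom_inv_mul [a, b] (dom_of_val (by simp) h))
  have hy' : P.Val ([P.inv b] ++ [P.inv a, a, b]) y := by simpa using hy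
  obtain ⟨z, hz⟩ := val_right hy'
  have h1 := val_contract (l := []) (v := [P.inv a, a]) (r := [b]) (y := P.one) (z := z)
    (Or.inr (by rw [P.prod_inv_mul]; exact Part.mem_some _)) hz
  have h2 := val_contract (l := [P.inv a]) (v := [a, b]) (r := []) (y := P.one) (z := z)
    h hz
  have e1 := val_delete_one (l := []) (r := [b]) h1
  have e2 := val_delete_one (l := [P.inv a]) (r := []) h2
  rw [List.nil_append, val_singleton_iff] at e1
  rw [List.append_nil, val_singleton_iff] at e2
  rw [← e1, e2]

theorem inv_inv (a : P) : P.inv (P.inv a) = a :=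
  (inv_unique (Or.inr (by rw [P.prod_inv_mul]; exact Part.mem_some _))).symm

theorem inv_one : P.inv P.one = P.one :=
  (inv_unique (Or.inr (by rw [P.prod_one_left]; exact Part.mem_some _))).symm

theorem invW_invW (w : List P) : P.invW (P.invW w) = w := by
  simp [invW, Function.comp_def, inv_inv]

theorem val_idem {e : P} (h : P.Val [e, e] e) : e = P.one := by
  obtain ⟨y, hy⟩ := exists_val_of_dom (P.dom_inv_mul [e, e] (dom_of_val (by simp) h))
  have hy' : P.Val ([P.inv e] ++ [P.inv e, e, e]) y := by simpa using hy
  obtain ⟨z, hz⟩ := val_right hy'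
  have h1 := val_contract (l := []) (v := [P.inv e, e]) (r := [e]) (y := P.one) (z := z)
    (Or.inr (by rw [P.prod_inv_mul]; exact Part.mem_some _)) hz
  have h2 := val_contract (l := [P.inv e]) (v := [e, e]) (r := []) (y := e) (z := z)
    h hz
  have e1 := val_delete_one (l := []) (r := [e]) h1
  rw [List.nil_append, val_singleton_iff] at e1
  have e2 : z = P.one :=
    val_unique h2 (Or.inr (by simp [P.prod_inv_mul]))
  rw [← e1, e2]

/-- `v` may be replaced by `w` in every sequence that has a product (auxiliary). -/
def Le (P : PartialGroup.{u}) (v w : List P) : Prop :=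
  ∀ l r z, P.Val (l ++ v ++ r) z → P.Val (l ++ w ++ r) z

theorem Le.refl (v : List P) : P.Le v v := fun _ _ _ h => h

theorem Le.trans {a b c : List P} (h : P.Le a b) (h' : P.Le b c) : P.Le a c :=
  fun l r z hz => h' l r z (h l r z hz)

theorem Le.append {a b c d : List P} (h : P.Le a b) (h' : P.Le c d) :
    P.Le (a ++ c) (b ++ d) := by
  intro l r z hz
  have h1 := h l (c ++ r) z (by simpa using hz)
  have h2 := h' (l ++ b) r z (by simpa using h1)
  simpa using h2

theorem Le.left {a b : List P} (l : List P) (h : P.Le a b) : P.Le (l ++ a) (l ++ b) :=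
  (Le.refl l).append h

theorem Le.right {a b : List P} (r : List P) (h : P.Le a b) : P.Le (a ++ r) (b ++ r) :=
  h.append (Le.refl r)

theorem Le.val {a b : List P} {z : P} (h : P.Le a b) (hz : P.Val a z) : P.Val b z := by
  simpa using h [] [] z (by simpa using hz)

theorem le_of_val {v : List P} {y : P} (h : P.Val v y) : P.Le v [y] :=
  fun _ _ _ hz => val_contract h hz

theorem le_insert_one : P.Le [] [P.one] := fun _ _ _ hz => val_insert_one (by simpa using hz)

theorem le_delete_one : P.Le [P.one] [] := fun _ _ _ hz => by
  simpa using val_delete_one hz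

theorem le_mul_inv (w : List P) : P.Le (w ++ P.invW w) [] := by
  induction w using List.reverseRecOn with
  | nil => exact Le.refl []
  | append_singleton w a ih =>
    have h : P.Le [a, P.inv a] [] :=
      (le_of_val (Or.inr (by rw [P.prod_mul_inv]; exact Part.mem_some _))).trans le_delete_one
    have := ((h.right (P.invW w)).left w).trans (by simpa using ih)
    simpa [invW_append, invW_singleton] using this

theorem le_inv_mul (w : List P) : P.Le (P.invW w ++ w) [] := by
  simpa [invW_invW] using le_mul_inv (P.invW w)

theorem exists_val_mul_inv {w : List P} {z : P} (h : P.Val w z) :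
    P.Val (w ++ P.invW w) P.one := by
  by_cases hw : w = []
  · subst hw; exact val_nil
  · obtain ⟨y, hy⟩ := exists_val_of_dom (P.dom_mul_inv w (dom_of_val hw h))
    have := (le_mul_inv w).val hy
    rw [val_unique this val_nil] at hy
    exact hy

theorem val_invW {w : List P} {z : P} (h : P.Val w z) : P.Val (P.invW w) (P.inv z) := by
  have h1 := exists_val_mul_inv h
  obtain ⟨y, hy⟩ := val_right h1
  have h2 := ((le_of_val h).append (le_of_val hy)).val h1
  rw [← inv_unique h2]
  exact hy

theorem exists_val_inv_mul {w : List P} {z : P} (h : P.Val w z) :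
    P.Val (P.invW w ++ w) P.one := by
  simpa [invW_invW] using exists_val_mul_inv (val_invW h)

theorem le_triple (w : List P) : P.Le w (w ++ P.invW w ++ w) := by
  intro l r z hz
  have h1 := exists_val_mul_inv hz
  have h2 := exists_val_mul_inv h1
  have h3 : P.Val (((l ++ w ++ r) ++ P.invW (l ++ w ++ r) ++ (l ++ w ++ r)) ++
      P.invW (l ++ w ++ r)) P.one := by
    simpa [invW_append, invW_invW] using h2
  obtain ⟨y, hy⟩ := val_left h3
  have hyz : P.Val (l ++ w ++ r) y := by
    have := ((le_mul_inv (l ++ w ++ r)).right (l ++ w ++ r)).val hy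
    simpa using this
  rw [val_unique hyz hz] at hy
  have h4 : P.Le ((l ++ w) ++ (r ++ P.invW r) ++ P.invW w ++ (P.invW l ++ l) ++ (w ++ r))
      ((l ++ w) ++ [] ++ P.invW w ++ [] ++ (w ++ r)) :=
    (((((le_mul_inv r).left (l ++ w))).right _).append (le_inv_mul l)).right _
  have := h4.val (z := z) (by simpa [invW_append] using hy)
  simpa using this

namespace Hom

variable {Q : PartialGroup.{u}}

theorem map_one (f : Hom Q P) : f Q.one = P.one := by
  apply val_idem
  have := f.map_prod [Q.one, Q.one] Q.one (by rw [Q.prod_one_left]; exact Part.mem_some _)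
  exact Or.inr (by simpa using this)

theorem map_inv (f : Hom Q P) (a : Q) : f (Q.inv a) = P.inv (f a) := by
  apply inv_unique
  have := f.map_prod [a, Q.inv a] Q.one (by rw [Q.prod_mul_inv]; exact Part.mem_some _)
  rw [f.map_one] at this
  exact Or.inr (by simpa using this)

theorem map_invW (f : Hom Q P) (w : List Q) : (Q.invW w).map f = P.invW (w.map f) := by
  simp [invW, Function.comp_def, f.map_inv]

theorem map_val (f : Hom Q P) {w : List Q} {z : Q} (h : Q.Val w z) : P.Val (w.map f) (f z) := by
  rcases h with ⟨rfl, rfl⟩ | h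
  · rw [f.map_one]; exact val_nil
  · exact Or.inr (f.map_prod w z h)

end Hom

end basic

/-- The set `𝒫ₙ` of sequences of length `n` that can be multiplied
(empty for `n = 0`, a case that is never used). -/
def Word (P : PartialGroup.{u}) (n : ℕ) : Type u := {w : List P // w.length = n ∧ (P.prod w).Dom}

namespace Word

variable {P Q : PartialGroup.{u}}

/-- The element `(π)` of `𝒫₁`. -/
def single (a : P) : P.Word 1 := ⟨[a], rfl, by rw [P.prod_singleton]; trivial⟩

/-- The element `π` of a sequence `(π)` of length one. -/
def toElt (x : P.Word 1) : P := x.1.head (List.ne_nil_of_length_pos (by simp [x.2.1]))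

/-- `φⁿ : 𝒬ₙ → 𝒫ₙ`. -/
def map (f : Hom Q P) {n : ℕ} (x : Q.Word n) : P.Word n :=
  ⟨x.1.map f, by simp [x.2.1], dom_of_val (by simpa using ne_nil_of_dom x.2.2)
    (f.map_val (exists_val_of_dom x.2.2).choose_spec)⟩

/-- `(π₁, …, πᵣ) ↦ (π₂, …, πᵣ)`, for `r > 1`. -/
def tail {n : ℕ} (x : P.Word (n + 2)) : P.Word (n + 1) :=
  ⟨x.1.tail, by simp [x.2.1], by
    obtain ⟨w, hl, hd⟩ := x
    match w, hl with
    | a :: b :: w, hl => exact P.dom_tail a _ (by simp) hd⟩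

/-- `(π₁, …, πᵣ) ↦ (π₁, …, πᵣ₋₁)`, for `r > 1`. -/
def init {n : ℕ} (x : P.Word (n + 2)) : P.Word (n + 1) :=
  ⟨x.1.dropLast, by simp [x.2.1], by
    obtain ⟨w, hl, hd⟩ := x
    have hw : w ≠ [] := ne_nil_of_dom hd
    refine P.dom_init _ (w.getLast hw) ?_ (by rw [List.dropLast_append_getLast]; exact hd)
    exact List.ne_nil_of_length_pos (by simp [hl])⟩

theorem split {p q r : ℕ} (x : P.Word (p + q + r)) :
    x.1.take p ++ (x.1.drop p).take q ++ x.1.drop (p + q) = x.1 := by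
  rw [List.append_assoc, ← List.drop_drop, List.take_append_drop, List.take_append_drop]

theorem dom_factor {p q r : ℕ} (hq : 0 < q) (x : P.Word (p + q + r)) :
    (P.prod ((x.1.drop p).take q)).Dom := by
  obtain ⟨z, hz⟩ := exists_val_of_dom x.2.2
  rw [← x.split] at hz
  obtain ⟨y, hy⟩ := val_mid hz
  exact dom_of_val (List.ne_nil_of_length_pos (by simp [x.2.1]; omega)) hy

/-- `id × ∇_q × id : 𝒫_{p+q+r} → 𝒫_{p+1+r}`, for `q > 0`. -/
def contract (p q r : ℕ) (hq : 0 < q) (x : P.Word (p + q + r)) : P.Word (p + 1 + r) :=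
  ⟨x.1.take p ++ [(P.prod ((x.1.drop p).take q)).get (dom_factor hq x)] ++ x.1.drop (p + q),
    by simp [x.2.1]; omega, by
    obtain ⟨z, hz⟩ := exists_val_of_dom x.2.2
    rw [← x.split] at hz
    exact dom_of_val (by simp) (val_contract (val_of_mem (Part.get_mem (dom_factor hq x))) hz)⟩

/-- `(π₁, …, πᵣ) ↦ (π₁, …, πᵢ, 1, πᵢ₊₁, …, πᵣ)`. -/
def insertOne {r : ℕ} (i : ℕ) (x : P.Word r) : P.Word (r + 1) :=
  ⟨x.1.take i ++ [P.one] ++ x.1.drop i,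
    by
      simp only [List.length_append, List.length_take, List.length_cons, List.length_nil,
        List.length_drop, x.2.1]
      omega,
    P.dom_insert_one _ _ (by rw [List.take_append_drop]; exact x.2.2)⟩

/-- `π ↦ π × π⁻¹`. -/
def mulInv {r : ℕ} (x : P.Word r) : P.Word (2 * r) :=
  ⟨x.1 ++ P.invW x.1, by simp [invW_length, x.2.1]; omega, P.dom_mul_inv x.1 x.2.2⟩

/-- `π ↦ π⁻¹ × π`. -/
def invMul {r : ℕ} (x : P.Word r) : P.Word (2 * r) :=
  ⟨P.invW x.1 ++ x.1, by simp [invW_length, x.2.1]; omega, P.dom_inv_mul x.1 x.2.2⟩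

end Word

end PartialGroup

open PartialGroup

/-- The structure of a (right) `𝒫`-set on `X`. The operations `◁ₙ : X𝒫ₙ → X` form one partial
function: `X𝒫ₙ` is the set of `(x | w)` with `w` of length `n` such that `act x w` is defined.
Here `X𝒫₀ = X` and `◁₀ = id`. -/
structure PAction (P : PartialGroup.{u}) (X : Type v) where
  act : X → List P →. X
  dom_sub : ∀ x w, w ≠ [] → (act x w).Dom → (P.prod w).Dom
  act_nil : ∀ x, act x [] = Part.some x
  /-- If `(x | π₁, …, πₙ₊₁)` is defined, so is `(x | π₁, …, πₙ)`. -/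
  dom_init : ∀ x w a, (act x (w ++ [a])).Dom → (act x w).Dom
  /-- If `(x | v, w)` is defined, then `◁(◁(x | v) | w)` is defined and equal to
  `◁(x | v, w)`. -/
  act_append : ∀ x v w y, y ∈ act x v → (act x (v ++ w)).Dom → act y w = act x (v ++ w)
  /-- If `(x | l, v, r)` is defined and `v` is non-empty, then `◁(x | l, ∇v, r)` is defined and
  equal to `◁(x | l, v, r)`. -/
  act_contract : ∀ x l v r c, v ≠ [] → c ∈ P.prod v → (act x (l ++ v ++ r)).Dom →
    act x (l ++ [c] ++ r) = act x (l ++ v ++ r)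
  /-- Units may be inserted, also into the empty sequence. -/
  dom_insert_one : ∀ x l r, (act x (l ++ r)).Dom → (act x (l ++ [P.one] ++ r)).Dom
  /-- The unit acts trivially. -/
  act_one : ∀ x, act x [P.one] = Part.some x
  /-- If `(x | w)` is defined, so is `(x | w × w⁻¹)`. -/
  dom_mul_inv : ∀ x w, (act x w).Dom → (act x (w ++ P.invW w)).Dom

/-- `f` is a map of `𝒫`-sets: if `(x | w) ∈ X𝒫ₙ`, `n > 0`, then `(f x | w) ∈ Y𝒫ₙ` and
`◁(f x | w) = f (◁(x | w))`. -/
def PAction.IsMap {P : PartialGroup.{u}} {X Y : Type v} (A : PAction P X) (B : PAction P Y)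
    (f : X → Y) : Prop :=
  ∀ x w y, w ≠ [] → y ∈ A.act x w → f y ∈ B.act (f x) w

/-- An `ℱ`-partial group: a partial group `ℋ` with the structure of an `ℱ`-set on every `ℋᵣ`,
`r > 0`, compatible with the structure of `ℋ`. -/
structure FPartialGroup (F : PartialGroup.{u}) : Type (u + 1) where
  grp : PartialGroup.{u}
  /-- Every `ℋᵣ`, `r > 0`, is an `ℱ`-set (nothing is said for `r = 0`, as `Word 0` is empty). -/
  action : ∀ r : ℕ, PAction F (grp.Word r)
  /-- Omitting the first or the last entry is a map of `ℱ`-sets. -/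
  isMap_tail : ∀ r, (action (r + 2)).IsMap (action (r + 1)) Word.tail
  isMap_init : ∀ r, (action (r + 2)).IsMap (action (r + 1)) Word.init
  /-- `id × ∇_q × id` is a map of `ℱ`-sets. -/
  isMap_contract : ∀ p q r (hq : 0 < q),
    (action (p + q + r)).IsMap (action (p + 1 + r)) (Word.contract p q r hq)
  /-- Inserting a unit is a map of `ℱ`-sets. -/
  isMap_insertOne : ∀ r i, i ≤ r → (action r).IsMap (action (r + 1)) (Word.insertOne i)
  /-- `(1 | w)` is defined for all `w ∈ ℱₙ`, and `◁(1 | w) = 1`. -/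
  act_one : ∀ w, (F.prod w).Dom → (action 1).act (Word.single grp.one) w =
    Part.some (Word.single grp.one)
  /-- `η ↦ η × η⁻¹` and `η ↦ η⁻¹ × η` are maps of `ℱ`-sets. -/
  isMap_mulInv : ∀ r, (action r).IsMap (action (2 * r)) Word.mulInv
  isMap_invMul : ∀ r, (action r).IsMap (action (2 * r)) Word.invMul

namespace FPartialGroup

instance (F : PartialGroup.{u}) : CoeSort (FPartialGroup F) (Type u) := ⟨fun H => H.grp⟩

/-- A map of `ℱ`-partial groups: a map `f` of partial groups such that `fⁿ : ℋₙ → 𝒫ₙ` is a map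
of `ℱ`-sets for all `n > 0`. -/
@[ext]
structure Hom {F : PartialGroup.{u}} (H P : FPartialGroup F) : Type u where
  hom : PartialGroup.Hom H.grp P.grp
  isMap : ∀ n, (H.action n).IsMap (P.action n) (Word.map hom)

instance {F : PartialGroup.{u}} (H P : FPartialGroup F) : CoeFun (Hom H P) (fun _ => H → P) :=
  ⟨fun f => f.hom⟩

/-- The category `PG_ℱ` of `ℱ`-partial groups. -/
instance (F : PartialGroup.{u}) : Category (FPartialGroup F) where
  Hom := Hom
  id H := ⟨𝟙 H.grp, fun n x w y _ h => by
    have e : ∀ x : H.grp.Word n, Word.map (𝟙 H.grp : H.grp ⟶ H.grp) x = x :=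
      fun x => Subtype.ext (List.map_id x.1)
    rw [e, e]; exact h⟩
  comp {A B C} f g := ⟨(f.hom ≫ g.hom : A.grp ⟶ C.grp), fun n x w y hw h => by
    have e : ∀ x : A.grp.Word n, Word.map (f.hom ≫ g.hom : A.grp ⟶ C.grp) x =
        Word.map g.hom (Word.map f.hom x) := fun x =>
      Subtype.ext (by simp [Word.map]; intro a _; rfl)
    rw [e, e]; exact g.isMap n _ w _ hw (f.isMap n x w y hw h)⟩

end FPartialGroup

theorem Part.eq_of_dom_of_mem {X : Type v} {a b : Part X} (hb : b.Dom)
    (h : ∀ z, z ∈ b → z ∈ a) : a = b :=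
  (Part.eq_some_iff.2 (h _ (Part.get_mem hb))).trans (Part.some_get hb)

namespace PartialGroup

section adjoint

variable {P : PartialGroup.{u}}

/-- The sequence `γ⁻¹ × (π) × γ`. -/
def blockW (P : PartialGroup.{u}) (γ : List P) (p : P) : List P := P.invW γ ++ [p] ++ γ

/-- The sequence `ρ(π | γ) = (γ⁻¹ × (π₁) × γ) × ⋯ × (γ⁻¹ × (πᵣ) × γ)`. -/
def conjW (P : PartialGroup.{u}) (γ π : List P) : List P := π.flatMap (P.blockW γ)

theorem conjW_cons (γ π : List P) (p : P) :
    P.conjW γ (p :: π) = P.blockW γ p ++ P.conjW γ π := by simp [conjW]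

theorem conjW_nil (γ : List P) : P.conjW γ [] = [] := rfl

theorem conjW_append (γ π π' : List P) :
    P.conjW γ (π ++ π') = P.conjW γ π ++ P.conjW γ π' := by simp [conjW]

theorem blockW_ne_nil (γ : List P) (p : P) : P.blockW γ p ≠ [] := by simp [blockW]

theorem conjW_ne_nil {γ π : List P} (h : π ≠ []) : P.conjW γ π ≠ [] := by
  obtain ⟨p, π, rfl⟩ := List.exists_cons_of_ne_nil h
  rw [conjW_cons]
  exact List.append_ne_nil_of_left_ne_nil (blockW_ne_nil γ p) _

theorem conjW_singleton (γ : List P) (p : P) : P.conjW γ [p] = P.blockW γ p := by simp [conjW]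

theorem conjW_nil_left (π : List P) : P.conjW [] π = π := by
  induction π with
  | nil => rfl
  | cons p π ih => rw [conjW_cons, ih]; simp [blockW, invW_nil]

theorem dom_blockW {γ π : List P} (h : (P.prod (P.conjW γ π)).Dom) (p : P) (hp : p ∈ π) :
    (P.prod (P.blockW γ p)).Dom := by
  obtain ⟨s, t, rfl⟩ := List.append_of_mem hp
  obtain ⟨z, hz⟩ := exists_val_of_dom h
  rw [conjW_append, conjW_cons, ← List.append_assoc] at hz
  obtain ⟨y, hy⟩ := val_mid hz
  exact dom_of_val (blockW_ne_nil γ p) hy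

theorem le_conjW_contract {γ π ys : List P}
    (h : List.Forall₂ (fun p q => P.Val (P.blockW γ p) q) π ys) : P.Le (P.conjW γ π) ys := by
  induction h with
  | nil => exact Le.refl []
  | cons h _ ih => rw [conjW_cons]; exact (le_of_val h).append ih

theorem forall₂_pmap {γ π : List P} (h : ∀ p ∈ π, (P.prod (P.blockW γ p)).Dom) :
    List.Forall₂ (fun p q => P.Val (P.blockW γ p) q) π
      (π.pmap (fun p hp => (P.prod (P.blockW γ p)).get hp) h) := by
  induction π with
  | nil => exact List.Forall₂.nil
  | cons p π ih =>
    rw [List.pmap_cons]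
    exact List.Forall₂.cons (val_of_mem (Part.get_mem _)) (ih _)

/-- The conjugation action of `𝒫` on `𝒫ᵣ`: the value at `(π | γ)` is defined if
`ρ(π | γ) ∈ 𝒫_{(2n+1)r}`, and its entries are `∇(γ⁻¹ × (πⱼ) × γ)`. -/
def adAct (P : PartialGroup.{u}) (r : ℕ) (x : P.Word r) : List P →. P.Word r := fun γ =>
  ⟨(P.prod (P.conjW γ x.1)).Dom, fun h =>
    ⟨x.1.pmap (fun p hp => (P.prod (P.blockW γ p)).get hp) (dom_blockW h), by simp [x.2.1], by
      obtain ⟨z, hz⟩ := exists_val_of_dom h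
      have := (le_conjW_contract (forall₂_pmap (dom_blockW h))).val hz
      refine dom_of_val ?_ this
      have := ne_nil_of_dom x.2.2
      simpa using this⟩⟩

theorem forall₂_val_unique {γ π y z : List P}
    (h : List.Forall₂ (fun p q => P.Val (P.blockW γ p) q) π y)
    (h' : List.Forall₂ (fun p q => P.Val (P.blockW γ p) q) π z) : y = z := by
  induction h generalizing z with
  | nil => cases h'; rfl
  | cons h _ ih =>
    cases h' with
    | cons h1 h2 => rw [val_unique h h1, ih h2]

theorem mem_adAct {r : ℕ} {x y : P.Word r} {γ : List P} :
    y ∈ P.adAct r x γ ↔ (P.prod (P.conjW γ x.1)).Dom ∧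
      List.Forall₂ (fun p q => P.Val (P.blockW γ p) q) x.1 y.1 := by
  constructor
  · rintro ⟨h, rfl⟩
    exact ⟨h, forall₂_pmap (dom_blockW h)⟩
  · rintro ⟨h, h'⟩
    exact ⟨h, Subtype.ext (forall₂_val_unique (forall₂_pmap (dom_blockW h)) h')⟩

theorem le_conjW_of_block {γ γ' : List P} (h : ∀ p, P.Le (P.blockW γ p) (P.blockW γ' p))
    (π : List P) : P.Le (P.conjW γ π) (P.conjW γ' π) := by
  induction π with
  | nil => exact Le.refl _
  | cons p π ih => rw [conjW_cons, conjW_cons]; exact (h p).append ih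

theorem adAct_of_le {r : ℕ} {x y : P.Word r} {γ γ' : List P}
    (h : ∀ p, P.Le (P.blockW γ p) (P.blockW γ' p)) (hy : y ∈ P.adAct r x γ) :
    y ∈ P.adAct r x γ' := by
  rw [mem_adAct] at hy ⊢
  obtain ⟨z, hz⟩ := exists_val_of_dom hy.1
  exact ⟨dom_of_val (conjW_ne_nil (ne_nil_of_dom x.2.2)) ((le_conjW_of_block h x.1).val hz),
    hy.2.imp fun p q hq => (h p).val hq⟩

theorem le_block_append {v w : List P} {p q : P} (h : P.Val (P.blockW v p) q) :
    P.Le (P.blockW (v ++ w) p) (P.blockW w q) := by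
  have := ((le_of_val h).left (P.invW w)).right w
  simpa [blockW, invW_append] using this

theorem le_conjW_append (u v : List P) {π : List P} (h : π ≠ []) :
    P.Le (P.conjW (u ++ v) π) (P.invW v ++ P.conjW u π ++ v) := by
  induction π with
  | nil => exact absurd rfl h
  | cons p π ih =>
    have e : P.blockW (u ++ v) p = P.invW v ++ P.blockW u p ++ v := by
      simp [blockW, invW_append]
    by_cases hπ : π = []
    · subst hπ
      rw [conjW_singleton, conjW_singleton, e]
      exact Le.refl _
    · rw [conjW_cons, conjW_cons, e]
      have h1 := (ih hπ).left (P.invW v ++ P.blockW u p ++ v)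
      refine h1.trans ?_
      have h2 := ((le_mul_inv v).left (P.invW v ++ P.blockW u p)).right (P.conjW u π ++ v)
      simpa using h2

theorem invW_blockW (γ : List P) (p : P) : P.invW (P.blockW γ p) = P.blockW γ (P.inv p) := by
  simp [blockW, invW_append, invW_invW, invW_cons]

theorem conjW_invW (γ π : List P) : P.conjW γ (P.invW π) = P.invW (P.conjW γ π) := by
  induction π with
  | nil => rfl
  | cons p π ih =>
    rw [invW_cons, conjW_append, conjW_singleton, conjW_cons, invW_append, ih, invW_blockW]

theorem forall₂_invW {γ π y : List P}
    (h : List.Forall₂ (fun p q => P.Val (P.blockW γ p) q) π y) :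
    List.Forall₂ (fun p q => P.Val (P.blockW γ p) q) (P.invW π) (P.invW y) := by
  rw [invW, invW, List.forall₂_reverse_iff, List.forall₂_map_left_iff, List.forall₂_map_right_iff]
  exact h.imp fun p q hq => by rw [← invW_blockW]; exact val_invW hq

/-- Conjugation makes `𝒫ᵣ` a `𝒫`-set. -/
def adAction (P : PartialGroup.{u}) (r : ℕ) : PAction P (P.Word r) where
  act := P.adAct r
  dom_sub x w _ h := by
    obtain ⟨p, hp⟩ := List.exists_mem_of_ne_nil _ (ne_nil_of_dom x.2.2)
    obtain ⟨y, hy⟩ := exists_val_of_dom (dom_blockW h p hp)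
    obtain ⟨z, hz⟩ := val_right hy
    exact dom_of_val ‹_› hz
  act_nil x := by
    rw [Part.eq_some_iff, mem_adAct, conjW_nil_left]
    exact ⟨x.2.2, List.forall₂_same.2 fun p _ => val_singleton p⟩
  dom_init x w a h := by
    obtain ⟨z, hz⟩ := exists_val_of_dom (P := P) h
    have hx := ne_nil_of_dom x.2.2
    obtain ⟨y, hy⟩ := val_mid ((le_conjW_append w [a] hx).val hz)
    exact dom_of_val (conjW_ne_nil hx) hy
  act_append x v w y hy h := by
    refine Part.eq_of_dom_of_mem h fun z hz => ?_
    rw [mem_adAct] at hy hz ⊢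
    have h1 : ∀ {π y : List P}, List.Forall₂ (fun p q => P.Val (P.blockW v p) q) π y →
        P.Le (P.conjW (v ++ w) π) (P.conjW w y) := by
      intro π y h
      induction h with
      | nil => exact Le.refl _
      | cons h _ ih => rw [conjW_cons, conjW_cons]; exact (le_block_append h).append ih
    have h2 : ∀ {π y z : List P}, List.Forall₂ (fun p q => P.Val (P.blockW v p) q) π y →
        List.Forall₂ (fun p q => P.Val (P.blockW (v ++ w) p) q) π z →
        List.Forall₂ (fun p q => P.Val (P.blockW w p) q) y z := by
      intro π y z h
      induction h generalizing z with
      | nil => intro h'; cases h'; exact List.Forall₂.nil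
      | cons h _ ih =>
        intro h'
        cases h' with
        | cons h3 h4 => exact List.Forall₂.cons ((le_block_append h).val h3) (ih h4)
    obtain ⟨c, hc⟩ := exists_val_of_dom hz.1
    exact ⟨dom_of_val (conjW_ne_nil (ne_nil_of_dom y.2.2)) ((h1 hy.2).val hc), h2 hy.2 hz.2⟩
  act_contract x l v r c _ hc h := by
    refine Part.eq_of_dom_of_mem h fun z hz => adAct_of_le (fun p => ?_) hz
    have h1 := le_of_val (val_of_mem hc)
    have h2 := le_of_val (val_invW (val_of_mem hc))
    have := ((((h2.left (P.invW r)).right (P.invW l)).right [p]).append ((h1.left l).right r))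
    simpa [blockW, invW_append, invW_cons, invW_nil] using this
  dom_insert_one x l r h := by
    obtain ⟨z, hz⟩ := Part.dom_iff_mem.1 h
    refine Part.dom_iff_mem.2 ⟨z, adAct_of_le (fun p => ?_) hz⟩
    have h1 := le_insert_one (P := P)
    have := ((((h1.left (P.invW r)).right (P.invW l)).right [p]).append ((h1.left l).right r))
    simpa [blockW, invW_append, invW_cons, invW_nil, inv_one] using this
  act_one x := by
    rw [Part.eq_some_iff]
    have h0 : x ∈ P.adAct r x [] := by
      rw [mem_adAct, conjW_nil_left]
      exact ⟨x.2.2, List.forall₂_same.2 fun p _ => val_singleton p⟩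
    refine adAct_of_le (fun p => ?_) h0
    have h1 := le_insert_one (P := P)
    have := (h1.right [p]).append h1
    simpa [blockW, invW_singleton, inv_one, invW_nil] using this
  dom_mul_inv x w h := by
    have hx := ne_nil_of_dom x.2.2
    obtain ⟨z, hz⟩ := exists_val_of_dom (P := P) h
    have h1 : ∀ p, P.Le (P.blockW w p) (P.blockW (w ++ P.invW w ++ w) p) := fun p => by
      have := ((le_triple (P.invW w)).right [p]).append (le_triple w)
      simpa [blockW, invW_append, invW_invW] using this
    have h2 := (le_conjW_of_block h1 x.1).val hz
    obtain ⟨y, hy⟩ := val_mid ((le_conjW_append (w ++ P.invW w) w hx).val h2)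
    exact dom_of_val (conjW_ne_nil hx) hy

theorem le_conjW_insert_one (γ : List P) {l r : List P} (h : l ++ r ≠ []) :
    P.Le (P.conjW γ (l ++ r)) (P.conjW γ (l ++ [P.one] ++ r)) := by
  rcases r with _ | ⟨p, r⟩
  · rcases List.eq_nil_or_concat l with rfl | ⟨l, p, rfl⟩
    · simp at h
    · have h1 : P.Le (P.blockW γ p) (P.blockW γ p ++ P.blockW γ P.one) := by
        have h2 := (le_triple γ).trans ((le_insert_one.left (γ ++ P.invW γ)).right γ |> fun t => by
          simpa using t)
        have := h2.left (P.invW γ ++ [p])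
        simpa [blockW] using this
      have := h1.left (P.conjW γ l)
      simpa [conjW_append, conjW_nil, conjW_cons] using this
  · have h1 : P.Le (P.blockW γ p) (P.blockW γ P.one ++ P.blockW γ p) := by
      have h2 : P.Le (P.invW γ) (P.invW γ ++ [P.one] ++ γ ++ P.invW γ) := by
        have h3 := ((le_insert_one (P := P)).left (P.invW γ)).right (γ ++ P.invW γ)
        refine (le_triple (P.invW γ)).trans ?_
        simpa [invW_invW] using h3
      have := h2.right ([p] ++ γ)
      simpa [blockW] using this
    have := (h1.left (P.conjW γ l)).right (P.conjW γ r)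
    simpa [conjW_append, conjW_cons] using this

theorem val_blockW_one {γ : List P} {q : P} (h : P.Val (P.blockW γ P.one) q) : q = P.one := by
  have := (le_delete_one.left (P.invW γ)).right γ
  have := (this.trans (by simpa using le_inv_mul γ)).val h
  exact val_unique this val_nil

/-- The adjoint `𝒫`-partial group `𝒫^ad`. -/
def ad (P : PartialGroup.{u}) : FPartialGroup P where
  grp := P
  action := P.adAction
  isMap_tail r x w y _ hy := by
    change _ ∈ P.adAct _ _ _ at hy
    change _ ∈ P.adAct _ _ _
    rw [mem_adAct] at hy ⊢
    obtain ⟨hd, hf⟩ := hy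
    have hn : x.1.tail ≠ [] := ne_nil_of_dom x.tail.2.2
    have e : [x.1.head (ne_nil_of_dom x.2.2)] ++ x.1.tail = x.1 := by simp
    obtain ⟨z, hz⟩ := exists_val_of_dom hd
    rw [← e, conjW_append] at hz
    obtain ⟨c, hc⟩ := val_right hz
    refine ⟨dom_of_val (conjW_ne_nil hn) hc, ?_⟩
    have := List.forall₂_drop 1 hf
    simpa [Word.tail] using this
  isMap_init r x w y _ hy := by
    change _ ∈ P.adAct _ _ _ at hy
    change _ ∈ P.adAct _ _ _
    rw [mem_adAct] at hy ⊢
    obtain ⟨hd, hf⟩ := hy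
    have hn : x.1.dropLast ≠ [] := ne_nil_of_dom x.init.2.2
    have e : x.1.dropLast ++ [x.1.getLast (ne_nil_of_dom x.2.2)] = x.1 :=
      List.dropLast_append_getLast _
    obtain ⟨z, hz⟩ := exists_val_of_dom hd
    rw [← e, conjW_append] at hz
    obtain ⟨c, hc⟩ := val_left hz
    refine ⟨dom_of_val (conjW_ne_nil hn) hc, ?_⟩
    have := List.forall₂_take (r + 1) hf
    simpa [Word.init, List.dropLast_eq_take, x.2.1, y.2.1] using this
  isMap_contract p q r hq x w y _ hy := by
    change _ ∈ P.adAct _ _ _ at hy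
    change _ ∈ P.adAct _ _ _
    rw [mem_adAct] at hy ⊢
    obtain ⟨hd, hf⟩ := hy
    have htn : (x.1.drop p).take q ≠ [] := ne_nil_of_dom (Word.dom_factor hq x)
    have hc := val_of_mem (Part.get_mem (Word.dom_factor hq x))
    have hc' := val_of_mem (Part.get_mem (Word.dom_factor hq y))
    have hs := List.forall₂_take p hf
    have ht := List.forall₂_take q (List.forall₂_drop p hf)
    have hu := List.forall₂_drop (p + q) hf
    have hle : P.Le (P.conjW w ((x.1.drop p).take q))
        (P.blockW w ((P.prod ((x.1.drop p).take q)).get (Word.dom_factor hq x))) := by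
      have h1 := le_conjW_append [] w htn
      rw [List.nil_append, conjW_nil_left] at h1
      exact h1.trans (((le_of_val hc).left (P.invW w)).right w)
    obtain ⟨z, hz⟩ := exists_val_of_dom hd
    rw [← x.split, conjW_append, conjW_append] at hz
    obtain ⟨e, he⟩ := val_mid hz
    have he' := (le_conjW_contract ht).val he
    have h2 := hle.val he
    rw [val_unique he' hc'] at h2
    constructor
    · have := ((hle.left _).right _).val hz
      refine dom_of_val (conjW_ne_nil (by simp [Word.contract])) (z := z) ?_
      simpa [Word.contract, conjW_append, conjW_cons] using this
    · exact List.rel_append (List.rel_append hs (List.Forall₂.cons h2 List.Forall₂.nil)) hu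
  isMap_insertOne r i _ x w y _ hy := by
    change _ ∈ P.adAct _ _ _ at hy
    change _ ∈ P.adAct _ _ _
    rw [mem_adAct] at hy ⊢
    obtain ⟨hd, hf⟩ := hy
    obtain ⟨z, hz⟩ := exists_val_of_dom hd
    have hx : x.1.take i ++ x.1.drop i ≠ [] := by
      rw [List.take_append_drop]; exact ne_nil_of_dom x.2.2
    have h1 : P.Val (P.conjW w (x.1.take i ++ [P.one] ++ x.1.drop i)) z :=
      (le_conjW_insert_one w hx).val (by rw [List.take_append_drop]; exact hz)
    refine ⟨dom_of_val (conjW_ne_nil (by simp [Word.insertOne])) h1, ?_⟩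
    rw [conjW_append, conjW_append, conjW_singleton] at h1
    obtain ⟨q, hq⟩ := val_mid h1
    have h2 := val_blockW_one hq
    subst h2
    exact List.rel_append (List.rel_append (List.forall₂_take i hf)
      (List.Forall₂.cons hq List.Forall₂.nil)) (List.forall₂_drop i hf)
  act_one w hw := by
    rw [Part.eq_some_iff]
    change _ ∈ P.adAct _ _ _
    obtain ⟨z, hz⟩ := exists_val_of_dom hw
    have h1 : P.Val (P.blockW w P.one) P.one := val_insert_one (exists_val_inv_mul hz)
    rw [mem_adAct]
    refine ⟨?_, List.Forall₂.cons h1 List.Forall₂.nil⟩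
    change (P.prod (P.conjW w [P.one])).Dom
    rw [conjW_singleton]
    exact dom_of_val (blockW_ne_nil _ _) h1
  isMap_mulInv r x w y _ hy := by
    change _ ∈ P.adAct _ _ _ at hy
    change _ ∈ P.adAct _ _ _
    rw [mem_adAct] at hy ⊢
    refine ⟨?_, List.rel_append hy.2 (forall₂_invW hy.2)⟩
    simp only [Word.mulInv, conjW_append, conjW_invW]
    exact P.dom_mul_inv _ hy.1
  isMap_invMul r x w y _ hy := by
    change _ ∈ P.adAct _ _ _ at hy
    change _ ∈ P.adAct _ _ _
    rw [mem_adAct] at hy ⊢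
    refine ⟨?_, List.rel_append (forall₂_invW hy.2) hy.2⟩
    simp only [Word.invMul, conjW_append, conjW_invW]
    exact P.dom_inv_mul _ hy.1

end adjoint

end PartialGroup

/-- Restriction of a `𝒢`-set along `φ : ℱ → 𝒢`. -/
def PAction.pullback {F G : PartialGroup.{u}} (φ : PartialGroup.Hom F G) {X : Type v}
    (A : PAction G X) : PAction F X where
  act x w := ⟨(w ≠ [] → (F.prod w).Dom) ∧ (A.act x (w.map φ)).Dom, fun h => (A.act x _).get h.2⟩
  dom_sub x w hw h := h.1 hw
  act_nil x := by
    rw [Part.eq_some_iff]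
    have h : x ∈ A.act x [] := by rw [A.act_nil]; exact Part.mem_some x
    exact ⟨⟨fun h => absurd rfl h, Part.dom_iff_mem.2 ⟨x, h⟩⟩, Part.get_eq_of_mem h _⟩
  dom_init x w a h := by
    refine ⟨fun hw => F.dom_init w a hw (h.1 (by simp)), A.dom_init x _ (φ a) ?_⟩
    simpa using h.2
  act_append x v w y hy h := by
    obtain ⟨hd, rfl⟩ := hy
    have e := A.act_append x (v.map φ) (w.map φ) _ (Part.get_mem hd.2) (by simpa using h.2)
    refine Part.eq_of_dom_of_mem h ?_
    rintro _ ⟨hz, rfl⟩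
    have hz2 : (A.act x (v.map φ ++ w.map φ)).Dom := by simpa using hz.2
    refine ⟨⟨fun hw => ?_, by simpa only [e] using hz2⟩, ?_⟩
    · obtain ⟨c, hc⟩ := exists_val_of_dom (hz.1 (by simp [hw]))
      obtain ⟨d, hd⟩ := val_right hc
      exact dom_of_val hw hd
    · simp only [e, List.map_append]
  act_contract x l v r c hv hc h := by
    have e := A.act_contract x (l.map φ) (v.map φ) (r.map φ) (φ c) (by simpa using hv)
      (φ.map_prod v c hc) (by simpa using h.2)
    refine Part.eq_of_dom_of_mem h ?_
    rintro _ ⟨hz, rfl⟩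
    refine ⟨⟨fun _ => ?_, ?_⟩, ?_⟩
    · have := hz.1 (by simp [hv])
      rwa [← F.prod_contract l v r c hv hc this] at this
    · have h2 := hz.2
      simp only [List.map_append, List.map_cons, List.map_nil] at e h2 ⊢
      rwa [e]
    · simp only [List.map_append, List.map_cons, List.map_nil] at e ⊢
      simp only [e]
  dom_insert_one x l r h := by
    refine ⟨fun _ => ?_, ?_⟩
    · by_cases hw : l ++ r = []
      · obtain ⟨rfl, rfl⟩ := List.append_eq_nil_iff.1 hw
        exact dom_of_val (by simp) (val_singleton F.one)
      · exact F.dom_insert_one l r (h.1 hw)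
    · have := A.dom_insert_one x (l.map φ) (r.map φ) (by simpa using h.2)
      simpa [φ.map_one] using this
  act_one x := by
    rw [Part.eq_some_iff]
    have h : x ∈ A.act x ([F.one].map φ) := by
      simp only [List.map_cons, List.map_nil, φ.map_one, A.act_one]; exact Part.mem_some x
    exact ⟨⟨fun _ => dom_of_val (by simp) (val_singleton F.one), Part.dom_iff_mem.2 ⟨x, h⟩⟩,
      Part.get_eq_of_mem h _⟩
  dom_mul_inv x w h := by
    refine ⟨fun hw => ?_, ?_⟩
    · have hw' : w ≠ [] := by rintro rfl; exact hw rfl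
      exact F.dom_mul_inv w (h.1 hw')
    · have := A.dom_mul_inv x _ h.2
      rwa [List.map_append, φ.map_invW]

theorem PAction.mem_pullback {F G : PartialGroup.{u}} {φ : PartialGroup.Hom F G} {X : Type v}
    {A : PAction G X} {x y : X} {w : List F} : y ∈ (A.pullback φ).act x w ↔
      (w ≠ [] → (F.prod w).Dom) ∧ y ∈ A.act x (w.map φ) :=
  ⟨fun ⟨h, e⟩ => ⟨h.1, h.2, e⟩, fun ⟨h, h', e⟩ => ⟨⟨h, h'⟩, e⟩⟩

theorem PAction.IsMap.pullback {F G : PartialGroup.{u}} (φ : PartialGroup.Hom F G) {X Y : Type v}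
    {A : PAction G X} {B : PAction G Y} {f : X → Y} (h : A.IsMap B f) :
    (A.pullback φ).IsMap (B.pullback φ) f := fun x w y hw hy => by
  rw [PAction.mem_pullback] at hy ⊢
  exact ⟨hy.1, h x _ y (by simpa using hw) hy.2⟩

namespace FPartialGroup

/-- Restriction of a `𝒢`-partial group along `φ : ℱ → 𝒢`. -/
def pullback {F G : PartialGroup.{u}} (φ : PartialGroup.Hom F G) (H : FPartialGroup G) :
    FPartialGroup F where
  grp := H.grp
  action r := (H.action r).pullback φ
  isMap_tail r := (H.isMap_tail r).pullback φ
  isMap_init r := (H.isMap_init r).pullback φ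
  isMap_contract p q r hq := (H.isMap_contract p q r hq).pullback φ
  isMap_insertOne r i hi := (H.isMap_insertOne r i hi).pullback φ
  act_one w hw := by
    rw [Part.eq_some_iff, PAction.mem_pullback, H.act_one]
    · exact ⟨fun _ => hw, Part.mem_some _⟩
    · obtain ⟨z, hz⟩ := Part.dom_iff_mem.1 hw
      exact Part.dom_iff_mem.2 ⟨_, φ.map_prod w z hz⟩
  isMap_mulInv r := (H.isMap_mulInv r).pullback φ
  isMap_invMul r := (H.isMap_invMul r).pullback φ

/-- The `ℱ`-partial group `𝒫^φ` of a map `φ : ℱ → 𝒫` of partial groups. -/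
def conj {F P : PartialGroup.{u}} (φ : PartialGroup.Hom F P) : FPartialGroup F := P.ad.pullback φ

/-- A map `χ : 𝒫 → 𝒬` with `χ ∘ φ = ψ`, as a map of `ℱ`-partial groups `𝒫^φ → 𝒬^ψ`. -/
def conjMap {F P Q : PartialGroup.{u}} {φ : PartialGroup.Hom F P} {ψ : PartialGroup.Hom F Q}
    (χ : PartialGroup.Hom P Q) (h : ∀ x, χ (φ x) = ψ x) : Hom (conj φ) (conj ψ) where
  hom := χ
  isMap n x w y _ hy := by
    have hb : ∀ p, (P.blockW (w.map φ) p).map χ = Q.blockW (w.map ψ) (χ p) := fun p => by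
      simp [blockW, χ.map_invW, Function.comp_def, h]
    have hc : ∀ π : List P, (P.conjW (w.map φ) π).map χ = Q.conjW (w.map ψ) (π.map χ) := by
      intro π
      induction π with
      | nil => rfl
      | cons p π ih => rw [conjW_cons, List.map_append, ih, hb, List.map_cons, conjW_cons]
    have hy := PAction.mem_pullback.1 hy
    refine PAction.mem_pullback.2 ⟨hy.1, ?_⟩
    have h1 := mem_adAct.1 hy.2
    refine mem_adAct.2 ⟨?_, ?_⟩
    · obtain ⟨z, hz⟩ := Part.dom_iff_mem.1 h1.1
      have := χ.map_prod _ _ hz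
      rw [hc] at this
      exact Part.dom_iff_mem.2 ⟨_, this⟩
    · exact List.forall₂_map_left_iff.2 (List.forall₂_map_right_iff.2
        (h1.2.imp fun p q hq => by rw [← hb]; exact χ.map_val hq))

/-- The functor `Φ : (ℱ ↓ PG) ⥤ PG_ℱ`, `φ ↦ 𝒫^φ`. -/
def Phi (F : PartialGroup.{u}) : Under F ⥤ FPartialGroup F where
  obj φ := conj φ.hom
  map {φ ψ} χ := conjMap (φ := φ.hom) (ψ := ψ.hom) χ.right fun x =>
    congrArg (fun k : PartialGroup.Hom F ψ.right => k x) (Under.w χ)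
  map_id _ := rfl
  map_comp _ _ := rfl

end FPartialGroup

namespace FPartialGroup

variable {F : PartialGroup.{u}}

/-- `◁(η | w)` for a single element `η` of `ℋ₁`. -/
def act₁ (H : FPartialGroup F) (η : H) (w : List F) : Part H :=
  ((H.action 1).act (Word.single η) w).map Word.toElt

section action

variable {H : FPartialGroup F}

/-- `(ξ | δ)` is defined and `ξ' = ◁(ξ | δ)`, for sequences `ξ` of any length (auxiliary). -/
def Act (H : FPartialGroup F) (ξ : List H) (δ : List F) (ξ' : List H) : Prop :=
  ∃ (n : ℕ) (x y : H.grp.Word n), x.1 = ξ ∧ y.1 = ξ' ∧ y ∈ (H.action n).act x δ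

theorem act_iff {n : ℕ} {x y : H.grp.Word n} {δ : List F} :
    H.Act x.1 δ y.1 ↔ y ∈ (H.action n).act x δ := by
  constructor
  · rintro ⟨m, x', y', hx, hy, h⟩
    have : m = n := by rw [← x'.2.1, hx, x.2.1]
    subst this
    rwa [Subtype.ext hx, Subtype.ext hy] at h
  · exact fun h => ⟨n, x, y, rfl, rfl, h⟩

theorem mem_act₁ {a b : H} {w : List F} : b ∈ H.act₁ a w ↔ H.Act [a] w [b] := by
  change _ ↔ H.Act (Word.single a).1 w (Word.single b).1
  rw [act_iff, act₁, Part.mem_map_iff]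
  constructor
  · rintro ⟨y, hy, rfl⟩
    have : Word.single (Word.toElt y) = y := by
      obtain ⟨y, hl, hd⟩ := y
      obtain ⟨c, rfl⟩ := List.length_eq_one_iff.1 hl
      rfl
    rwa [this]
  · exact fun h => ⟨_, h, rfl⟩

namespace Act

variable {ξ ξ' ζ y : List H} {δ : List F}

theorem unique (h : H.Act ξ δ y) (h' : H.Act ξ δ ζ) : y = ζ := by
  obtain ⟨n, x, y, rfl, rfl, h⟩ := h
  obtain ⟨m, x', y', hx, rfl, h'⟩ := h'
  have : m = n := by rw [← x'.2.1, hx, x.2.1]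
  subst this
  rw [Subtype.ext hx] at h'
  exact congrArg Subtype.val (Part.mem_unique h h')

theorem len (h : H.Act ξ δ y) : ξ.length = y.length := by
  obtain ⟨n, x, y, rfl, rfl, h⟩ := h
  rw [x.2.1, y.2.1]

theorem dom_left (h : H.Act ξ δ y) : (H.grp.prod ξ).Dom := by
  obtain ⟨n, x, y, rfl, rfl, h⟩ := h
  exact x.2.2

theorem dom_right (h : H.Act ξ δ y) : (H.grp.prod y).Dom := by
  obtain ⟨n, x, y, rfl, rfl, h⟩ := h
  exact y.2.2

theorem nil (h : (H.grp.prod ξ).Dom) : H.Act ξ [] ξ := by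
  have key : ∀ x : H.grp.Word ξ.length, H.Act x.1 [] x.1 := fun x => by
    rw [act_iff, PAction.act_nil]; exact Part.mem_some _
  exact key ⟨ξ, rfl, h⟩

theorem split {v w : List F} (h : H.Act ξ (v ++ w) ζ) : ∃ y, H.Act ξ v y ∧ H.Act y w ζ := by
  obtain ⟨n, x, z, rfl, rfl, h⟩ := h
  have hd : ∀ w : List F, ((H.action n).act x (v ++ w)).Dom → ((H.action n).act x v).Dom := by
    intro w
    induction w using List.reverseRecOn with
    | nil => simp
    | append_singleton w a ih =>
      rw [← List.append_assoc]
      exact fun h => ih ((H.action n).dom_init _ _ _ h)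
  obtain ⟨y, hy⟩ := Part.dom_iff_mem.1 (hd w (Part.dom_iff_mem.2 ⟨z, h⟩))
  refine ⟨y.1, act_iff.2 hy, act_iff.2 ?_⟩
  rw [(H.action n).act_append x v w y hy (Part.dom_iff_mem.2 ⟨z, h⟩)]
  exact h

theorem after {v w : List F} (h : H.Act ξ (v ++ w) ζ) (h' : H.Act ξ v y) : H.Act y w ζ := by
  obtain ⟨y', h1, h2⟩ := h.split
  rwa [h'.unique h1]

theorem insert_one {l r : List F} (h : H.Act ξ (l ++ r) ζ) :
    H.Act ξ (l ++ [F.one] ++ r) ζ := by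
  have h0 := h
  obtain ⟨n, x, z, rfl, rfl, h⟩ := h
  obtain ⟨z', hz'⟩ := Part.dom_iff_mem.1
    ((H.action n).dom_insert_one x l r (Part.dom_iff_mem.2 ⟨z, h⟩))
  have h1 := act_iff.2 hz'
  obtain ⟨y, hy, hy'⟩ := h0.split
  rw [List.append_assoc] at h1
  have h2 := h1.after hy
  obtain ⟨t, ht, ht'⟩ := h2.split
  have e : t = y := by
    obtain ⟨m, a, b, rfl, rfl, hab⟩ := ht
    rw [PAction.act_one, Part.mem_some_iff] at hab
    rw [hab]
  subst e
  have := ht'.unique hy'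
  rw [← this, List.append_assoc]
  exact h1

theorem contract {l v r : List F} {c : F} (hv : F.Val v c) (h : H.Act ξ (l ++ v ++ r) ζ) :
    H.Act ξ (l ++ [c] ++ r) ζ := by
  by_cases hn : v = []
  · subst hn
    rw [val_unique hv val_nil]
    exact insert_one (by simpa using h)
  · obtain ⟨n, x, z, rfl, rfl, h⟩ := h
    refine act_iff.2 ?_
    rw [(H.action n).act_contract x l v r c hn (mem_of_val hn hv) (Part.dom_iff_mem.2 ⟨z, h⟩)]
    exact h

theorem act_one_eq {a : F} (ha : a = F.one) (h : H.Act ξ [a] ζ) : ζ = ξ := by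
  subst ha
  obtain ⟨m, a, b, rfl, rfl, hab⟩ := h
  rw [PAction.act_one, Part.mem_some_iff] at hab
  rw [hab]

theorem delete_one {l r : List F} (h : H.Act ξ (l ++ [F.one] ++ r) ζ) : H.Act ξ (l ++ r) ζ := by
  rcases r with _ | ⟨a, r⟩
  · rcases List.eq_nil_or_concat l with rfl | ⟨l, a, rfl⟩
    · have e : ζ = ξ := act_one_eq rfl (show H.Act ξ [F.one] ζ by simpa using h)
      rw [e]
      exact nil h.dom_left
    · have := contract (l := l) (v := [a, F.one]) (r := []) (c := a)
          (Or.inr (by rw [F.prod_one_right]; exact Part.mem_some a)) (by simpa using h)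
      simpa using this
  · have := contract (l := l) (v := [F.one, a]) (r := r) (c := a)
        (Or.inr (by rw [F.prod_one_left]; exact Part.mem_some a)) (by simpa using h)
    simpa using this

theorem val (h : H.Act ξ δ ζ) : ∃ c, F.Val δ c := by
  by_cases hn : δ = []
  · subst hn; exact ⟨_, val_nil⟩
  · obtain ⟨n, x, z, rfl, rfl, h⟩ := h
    exact exists_val_of_dom ((H.action n).dom_sub x δ hn (Part.dom_iff_mem.2 ⟨z, h⟩))

theorem cancel {l w r : List F} (h : H.Act ξ (l ++ w ++ F.invW w ++ r) ζ) :
    H.Act ξ (l ++ r) ζ := by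
  obtain ⟨y, _, h2⟩ := (show H.Act ξ (l ++ (w ++ (F.invW w ++ r))) ζ by simpa using h).split
  obtain ⟨_, h3, _⟩ := h2.split
  obtain ⟨c, hc⟩ := h3.val
  exact (contract (l := l) (v := w ++ F.invW w) (exists_val_mul_inv hc)
    (by simpa using h)).delete_one

theorem mulInv (h : H.Act ξ δ ζ) : H.Act ξ (δ ++ F.invW δ) ξ := by
  obtain ⟨n, x, z, rfl, rfl, h⟩ := h
  obtain ⟨z', hz'⟩ := Part.dom_iff_mem.1
    ((H.action n).dom_mul_inv x δ (Part.dom_iff_mem.2 ⟨z, h⟩))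
  have h1 := act_iff.2 hz'
  have h2 := cancel (l := []) (w := δ) (r := []) (by simpa using h1)
  rw [h2.unique (nil x.2.2)] at h1
  exact h1

theorem inv (h : H.Act ξ δ ζ) : H.Act ζ (F.invW δ) ξ := h.mulInv.after h

theorem triple {t w : List F} (h : H.Act ξ (t ++ w) ζ) :
    H.Act ξ (t ++ F.invW t ++ t ++ w) ζ := by
  have h1 := h.mulInv.mulInv
  have h2 : H.Act ξ ((t ++ w ++ F.invW w ++ F.invW t ++ t ++ w) ++ (F.invW w ++ F.invW t)) ξ := by
    simpa [invW_append, invW_invW] using h1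
  obtain ⟨y, hy, _⟩ := h2.split
  have h3 : H.Act ξ (t ++ (F.invW t ++ t ++ w)) y :=
    cancel (l := t) (w := w) (by simpa using hy)
  have h4 : H.Act ξ ([] ++ (t ++ w)) y := cancel (l := []) (w := t) (by simpa using h3)
  rw [h4.unique h] at h3
  simpa using h3

theorem through {t w : List F} (h : H.Act ξ t y) (h' : H.Act y (F.invW t ++ w) ζ) :
    H.Act ξ (t ++ F.invW t ++ w) ζ := by
  have h1 := h'.triple
  rw [invW_invW] at h1
  have h2 : H.Act y (F.invW t ++ (t ++ F.invW t ++ w)) ζ := by simpa using h1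
  exact h2.after h.inv

theorem of_isMap {m n : ℕ} {f : H.grp.Word m → H.grp.Word n}
    (hf : (H.action m).IsMap (H.action n) f) {x y : H.grp.Word m} (h : H.Act x.1 δ y.1) :
    H.Act (f x).1 δ (f y).1 := by
  rw [act_iff] at h ⊢
  by_cases hn : δ = []
  · subst hn
    rw [PAction.act_nil, Part.mem_some_iff] at h ⊢
    rw [h]
  · exact hf x δ y hn h

theorem tail {a b : H} (h : H.Act (a :: ξ) δ (b :: ζ)) (hξ : ξ ≠ []) : H.Act ξ δ ζ := by
  obtain ⟨n, x, y, hx, hy, hxy⟩ := h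
  obtain ⟨r, rfl⟩ : ∃ r, n = r + 2 := by
    have h1 := x.2.1
    rw [hx] at h1
    have := List.length_pos_of_ne_nil hξ
    exact ⟨n - 2, by simp at h1; omega⟩
  have := of_isMap (H.isMap_tail r) (act_iff.2 hxy)
  simpa [Word.tail, hx, hy] using this

theorem init {a b : H} (h : H.Act (ξ ++ [a]) δ (ζ ++ [b])) (hξ : ξ ≠ []) : H.Act ξ δ ζ := by
  obtain ⟨n, x, y, hx, hy, hxy⟩ := h
  obtain ⟨r, rfl⟩ : ∃ r, n = r + 2 := by
    have h1 := x.2.1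
    rw [hx] at h1
    have := List.length_pos_of_ne_nil hξ
    exact ⟨n - 2, by simp at h1; omega⟩
  have := of_isMap (H.isMap_init r) (act_iff.2 hxy)
  simpa [Word.init, hx, hy] using this

theorem right {ξ₁ ξ₂ ζ₁ ζ₂ : List H} (hl : ξ₁.length = ζ₁.length) (hn : ξ₂ ≠ [])
    (h : H.Act (ξ₁ ++ ξ₂) δ (ζ₁ ++ ζ₂)) : H.Act ξ₂ δ ζ₂ := by
  induction ξ₁ generalizing ζ₁ with
  | nil =>
    cases ζ₁ with
    | nil => exact h
    | cons _ _ => simp at hl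
  | cons a ξ₁ ih =>
    cases ζ₁ with
    | nil => simp at hl
    | cons b ζ₁ => exact ih (by simpa using hl) (h.tail (by simp [hn]))

theorem left {ξ₁ ξ₂ ζ₁ ζ₂ : List H} (hl : ξ₁.length = ζ₁.length) (hn : ξ₁ ≠ [])
    (h : H.Act (ξ₁ ++ ξ₂) δ (ζ₁ ++ ζ₂)) : H.Act ξ₁ δ ζ₁ := by
  induction ξ₂ using List.reverseRecOn generalizing ζ₂ with
  | nil =>
    have := h.len
    have : ζ₂ = [] := List.length_eq_zero_iff.1 (by simp at this; omega)
    subst this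
    simpa using h
  | append_singleton ξ₂ a ih =>
    rcases List.eq_nil_or_concat ζ₂ with rfl | ⟨ζ₂, b, rfl⟩
    · have := h.len
      simp at this
      omega
    · refine ih (ζ₂ := ζ₂) (init (a := a) (b := b) ?_ (by simp [hn]))
      simpa using h

theorem mid {ξ₁ ξ₂ ξ₃ ζ₁ ζ₂ ζ₃ : List H} (hl : ξ₁.length = ζ₁.length)
    (hl' : ξ₂.length = ζ₂.length) (hn : ξ₂ ≠ [])
    (h : H.Act (ξ₁ ++ ξ₂ ++ ξ₃) δ (ζ₁ ++ ζ₂ ++ ζ₃)) : H.Act ξ₂ δ ζ₂ :=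
  (h.left (by simp [hl, hl']) (by simp [hn])).right hl hn

theorem forall₂ (h : H.Act ξ δ ζ) : List.Forall₂ (fun a b => H.Act [a] δ [b]) ξ ζ := by
  induction ξ generalizing ζ with
  | nil => exact absurd rfl (ne_nil_of_dom h.dom_left)
  | cons a ξ ih =>
    cases ζ with
    | nil => exact absurd rfl (ne_nil_of_dom h.dom_right)
    | cons b ζ =>
      refine List.Forall₂.cons (left (ξ₁ := [a]) (ζ₁ := [b]) rfl (by simp) h) ?_
      by_cases hξ : ξ = []
      · subst hξ
        have := h.len
        have : ζ = [] := List.length_eq_zero_iff.1 (by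
          simp only [List.length_cons, List.length_nil] at this; omega)
        subst this
        exact List.Forall₂.nil
      · exact ih (h.tail hξ)

theorem contractH {a b c a' b' c' : List H} {e : H} (ha : a.length = a'.length)
    (hb : b.length = b'.length) (hn : b ≠ []) (he : H.grp.Val b e)
    (h : H.Act (a ++ b ++ c) δ (a' ++ b' ++ c')) :
    ∃ e', H.grp.Val b' e' ∧ H.Act (a ++ [e] ++ c) δ (a' ++ [e'] ++ c') := by
  obtain ⟨n, x, y, hx, hy, hxy⟩ := h
  have hn' : n = a.length + b.length + c.length := by
    rw [← x.2.1, hx]; simp only [List.length_append]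
  subst hn'
  have hq := List.length_pos_of_ne_nil hn
  have := of_isMap (H.isMap_contract a.length b.length c.length hq) (act_iff.2 hxy)
  have hb1 : (x.1.drop a.length).take b.length = b := by rw [hx]; simp
  have hb2 : (y.1.drop a.length).take b.length = b' := by rw [hy, ha, hb]; simp
  have e1 := val_of_mem (Part.get_mem (Word.dom_factor hq x))
  have e2 := val_of_mem (Part.get_mem (Word.dom_factor hq y))
  have e1' : (H.grp.prod ((x.1.drop a.length).take b.length)).get (Word.dom_factor hq x) = e :=
    val_unique e1 (by rwa [hb1])
  simp only [Word.contract, e1'] at this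
  generalize (H.grp.prod ((y.1.drop a.length).take b.length)).get (Word.dom_factor hq y) = g
    at e2 this
  rw [hb2] at e2
  refine ⟨g, e2, ?_⟩
  have t1 : x.1.take a.length = a := by rw [hx]; simp
  have t2 : x.1.drop (a.length + b.length) = c := by rw [hx]; simp
  have t3 : y.1.take a.length = a' := by rw [hy, ha]; simp
  have t4 : y.1.drop (a.length + b.length) = c' := by
    rw [hy, ha, hb, ← List.length_append, List.drop_left]
  rw [t1, t2, t3, t4] at this
  exact this

theorem insertH {a c a' c' : List H} (ha : a.length = a'.length)
    (h : H.Act (a ++ c) δ (a' ++ c')) :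
    H.Act (a ++ [H.grp.one] ++ c) δ (a' ++ [H.grp.one] ++ c') := by
  obtain ⟨n, x, y, hx, hy, hxy⟩ := h
  have hn : a.length ≤ n := by rw [← x.2.1, hx]; simp
  have := of_isMap (H.isMap_insertOne n a.length hn) (act_iff.2 hxy)
  have t1 : x.1.take a.length = a := by rw [hx]; simp
  have t2 : x.1.drop a.length = c := by rw [hx]; simp
  have t3 : y.1.take a.length = a' := by rw [hy, ha]; simp
  have t4 : y.1.drop a.length = c' := by rw [hy, ha]; simp
  simpa [Word.insertOne, t1, t2, t3, t4] using this

theorem mulInvH (h : H.Act ξ δ ζ) : H.Act (ξ ++ H.grp.invW ξ) δ (ζ ++ H.grp.invW ζ) := by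
  obtain ⟨n, x, y, rfl, rfl, hxy⟩ := h
  exact of_isMap (H.isMap_mulInv n) (act_iff.2 hxy)

theorem invH {a b : H} (h : H.Act [a] δ [b]) : H.Act [H.grp.inv a] δ [H.grp.inv b] :=
  right (ξ₁ := [a]) (ζ₁ := [b]) rfl (by simp) h.mulInvH

theorem one_one {c : F} (h : F.Val δ c) : H.Act [H.grp.one] δ [H.grp.one] := by
  by_cases hn : δ = []
  · subst hn
    exact nil (by rw [H.grp.prod_singleton]; trivial)
  · change H.Act (Word.single H.grp.one).1 δ (Word.single H.grp.one).1
    rw [act_iff, H.act_one δ (dom_of_val hn h)]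
    exact Part.mem_some _

theorem exists_single {a : H} (h : H.Act [a] δ ζ) : ∃ b, ζ = [b] :=
  List.length_eq_one_iff.1 h.len.symm

theorem split₁ {a c : H} {v w : List F} (h : H.Act [a] (v ++ w) [c]) :
    ∃ b, H.Act [a] v [b] ∧ H.Act [b] w [c] := by
  obtain ⟨y, h1, h2⟩ := h.split
  obtain ⟨b, rfl⟩ := h1.exists_single
  exact ⟨b, h1, h2⟩

theorem unique₁ {a b c : H} (h : H.Act [a] δ [b]) (h' : H.Act [a] δ [c]) : b = c := by
  simpa using h.unique h'

end Act

theorem forall₂_unique {ξ y z : List H} {δ : List F}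
    (h : List.Forall₂ (fun a b => H.Act [a] δ [b]) ξ y)
    (h' : List.Forall₂ (fun a b => H.Act [a] δ [b]) ξ z) : y = z := by
  induction h generalizing z with
  | nil => cases h'; rfl
  | cons h _ ih =>
    cases h' with
    | cons h1 h2 => rw [h.unique₁ h1, ih h2]

theorem dom_act₁ {a : H} {w : List F} : (H.act₁ a w).Dom ↔ ∃ b, H.Act [a] w [b] := by
  simp only [Part.dom_iff_mem, mem_act₁]

end action

/-- The set `(ℱ ⋉ ℋ)₁` of all `γ ⋉ η = (γ, η)` such that `(η | γ⁻¹) ∈ ℋ₁ℱ₁`. -/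
def SemiElt (H : FPartialGroup F) : Type u :=
  {p : F × H // (H.act₁ p.2 [F.inv p.1]).Dom}

/-- The sequence `(γ₁, …, γₙ)` of `(γᵢ ⋉ ηᵢ)ᵢ`. -/
def fstW {H : FPartialGroup F} (α : List H.SemiElt) : List F := α.map fun a => a.1.1

/-- The sequence
`A(α) = (◁(η₁ | γ₂, …, γₙ), ◁(η₂ | γ₃, …, γₙ), …, ◁(ηₙ₋₁ | γₙ), ηₙ)` of `α = (γᵢ ⋉ ηᵢ)ᵢ`.
It is defined if and only if `(ηⱼ | γⱼ₊₁, …, γₙ) ∈ ℋ₁ℱₙ₋ⱼ` for all `1 ≤ j < n`. -/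
def seqA (H : FPartialGroup F) : List H.SemiElt → Part (List H)
  | [] => Part.some []
  | a :: α => (H.act₁ a.1.2 (fstW α)).bind fun ξ => (H.seqA α).map fun ζ => ξ :: ζ

/-- The condition `A⁺(α) = (A(α) | γₙ⁻¹, …, γ₁⁻¹) ∈ ℋₙℱₙ` that defines `(ℱ ⋉ ℋ)ₙ`. -/
def SemiDom (H : FPartialGroup F) (α : List H.SemiElt) : Prop :=
  ∃ x : H.grp.Word α.length, x.1 ∈ H.seqA α ∧
    ((H.action α.length).act x (F.invW (fstW α))).Dom

section semidirect

variable {H : FPartialGroup F}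

/-- Relational form of `seqA`, with the sequence `(γᵢ)ᵢ` extended by `σ` (auxiliary). -/
def TA (σ : List F) : List H.SemiElt → List H → Prop
  | [], ξ => ξ = []
  | a :: α, ξ => ∃ x ζ, ξ = x :: ζ ∧ H.Act [a.1.2] (fstW α ++ σ) [x] ∧ TA σ α ζ

theorem mem_seqA {α : List H.SemiElt} {ξ : List H} : ξ ∈ H.seqA α ↔ TA [] α ξ := by
  induction α generalizing ξ with
  | nil => exact Part.mem_some_iff
  | cons a α ih =>
    simp only [seqA, Part.mem_bind_iff, Part.mem_map_iff, mem_act₁, TA, List.append_nil, ih]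
    constructor
    · rintro ⟨x, h1, ζ, h2, rfl⟩
      exact ⟨x, ζ, rfl, h1, h2⟩
    · rintro ⟨x, ζ, rfl, h1, h2⟩
      exact ⟨x, h1, ζ, h2, rfl⟩

theorem TA.len {σ : List F} {α : List H.SemiElt} {ξ : List H} (h : TA σ α ξ) :
    ξ.length = α.length := by
  induction α generalizing ξ with
  | nil => rw [show ξ = [] from h]; rfl
  | cons a α ih =>
    obtain ⟨x, ζ, rfl, _, h2⟩ := h
    simp [ih h2]

theorem TA.unique {σ : List F} {α : List H.SemiElt} {ξ ζ : List H} (h : TA σ α ξ)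
    (h' : TA σ α ζ) : ξ = ζ := by
  induction α generalizing ξ ζ with
  | nil => rw [show ξ = [] from h, show ζ = [] from h']
  | cons a α ih =>
    obtain ⟨x, ξ, rfl, h1, h2⟩ := h
    obtain ⟨y, ζ, rfl, h3, h4⟩ := h'
    rw [h1.unique₁ h3, ih h2 h4]

theorem semiDom_iff {α : List H.SemiElt} :
    H.SemiDom α ↔ ∃ ξ ζ, TA [] α ξ ∧ H.Act ξ (F.invW (fstW α)) ζ := by
  constructor
  · rintro ⟨x, hx, hd⟩
    obtain ⟨y, hy⟩ := Part.dom_iff_mem.1 hd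
    exact ⟨x.1, y.1, mem_seqA.1 hx, act_iff.2 hy⟩
  · rintro ⟨ξ, ζ, h1, n, x, y, rfl, rfl, h2⟩
    have : n = α.length := by rw [← x.2.1, h1.len]
    subst this
    exact ⟨x, mem_seqA.2 h1, Part.dom_iff_mem.2 ⟨y, h2⟩⟩

theorem SemiDom.dom_fst {α : List H.SemiElt} (h : H.SemiDom α) : (F.prod (fstW α)).Dom := by
  obtain ⟨ξ, ζ, h1, h2⟩ := semiDom_iff.1 h
  obtain ⟨c, hc⟩ := h2.val
  have := val_invW hc
  rw [invW_invW] at this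
  refine dom_of_val ?_ this
  have h3 := List.length_pos_of_ne_nil (ne_nil_of_dom h2.dom_left)
  rw [h1.len] at h3
  exact List.ne_nil_of_length_pos (by simpa [fstW] using h3)

theorem SemiDom.dom_seqA {α : List H.SemiElt} (h : H.SemiDom α) : (H.seqA α).Dom :=
  Part.dom_iff_mem.2 ⟨_, h.choose_spec.1⟩

theorem SemiDom.dom_snd {α : List H.SemiElt} (h : H.SemiDom α) :
    (H.grp.prod ((H.seqA α).get h.dom_seqA)).Dom := by
  obtain ⟨x, hx, _⟩ := id h
  rw [Part.get_eq_of_mem hx]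
  exact x.2.2

theorem SemiDom.mem {α : List H.SemiElt} (h : H.SemiDom α) :
    (H.act₁ ((H.grp.prod ((H.seqA α).get h.dom_seqA)).get h.dom_snd)
      [F.inv ((F.prod (fstW α)).get h.dom_fst)]).Dom := by
  obtain ⟨ξ, ζ, h1, h2⟩ := semiDom_iff.1 h
  have e : (H.seqA α).get h.dom_seqA = ξ := Part.get_eq_of_mem (mem_seqA.2 h1) _
  have v1 := val_of_mem (Part.get_mem h.dom_snd)
  have v2 := val_invW (val_of_mem (Part.get_mem h.dom_fst))
  have v1' : H.grp.Val ξ ((H.grp.prod ((H.seqA α).get h.dom_seqA)).get h.dom_snd) := by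
    generalize (H.grp.prod ((H.seqA α).get h.dom_seqA)).get h.dom_snd = g at v1 ⊢
    rwa [e] at v1
  rw [dom_act₁]
  have h3 := Act.contract (l := []) (r := []) v2 (by simpa using h2)
  obtain ⟨d, _, h4⟩ := Act.contractH (a := []) (c := []) (a' := []) (c' := []) rfl h3.len
    (ne_nil_of_dom h3.dom_left) v1' (by simpa using h3)
  exact ⟨d, h4⟩

/-- `∇(α) = ∇((γᵢ)ᵢ) ⋉ ∇(A(α))`. -/
def semiProd (H : FPartialGroup F) : List H.SemiElt →. H.SemiElt := fun α =>
  ⟨H.SemiDom α, fun h =>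
    ⟨((F.prod (fstW α)).get h.dom_fst, (H.grp.prod ((H.seqA α).get h.dom_seqA)).get h.dom_snd),
      h.mem⟩⟩

theorem mem_semiProd {α : List H.SemiElt} {p : H.SemiElt} :
    p ∈ H.semiProd α ↔ ∃ ξ ζ, TA [] α ξ ∧ H.Act ξ (F.invW (fstW α)) ζ ∧
      F.Val (fstW α) p.1.1 ∧ H.grp.Val ξ p.1.2 := by
  constructor
  · rintro ⟨h, rfl⟩
    obtain ⟨ξ, ζ, h1, h2⟩ := semiDom_iff.1 h
    have e : (H.seqA α).get h.dom_seqA = ξ := Part.get_eq_of_mem (mem_seqA.2 h1) _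
    refine ⟨ξ, ζ, h1, h2, val_of_mem (Part.get_mem h.dom_fst), ?_⟩
    have := val_of_mem (Part.get_mem (SemiDom.dom_snd h))
    change H.grp.Val ξ ((H.grp.prod ((H.seqA α).get (SemiDom.dom_seqA h))).get (SemiDom.dom_snd h))
    generalize (H.grp.prod ((H.seqA α).get (SemiDom.dom_seqA h))).get (SemiDom.dom_snd h) = g
      at this ⊢
    rwa [e] at this
  · rintro ⟨ξ, ζ, h1, h2, h3, h4⟩
    have h : H.SemiDom α := semiDom_iff.2 ⟨ξ, ζ, h1, h2⟩
    refine ⟨h, Subtype.ext (Prod.ext ?_ ?_)⟩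
    · exact val_unique (val_of_mem (Part.get_mem h.dom_fst)) h3
    · have e : (H.seqA α).get h.dom_seqA = ξ := Part.get_eq_of_mem (mem_seqA.2 h1) _
      have := val_of_mem (Part.get_mem h.dom_snd)
      rw [← e] at h4
      exact val_unique this h4

/-- `(γ ⋉ η)⁻¹ = γ⁻¹ ⋉ ◁(η | γ⁻¹)⁻¹`. -/
def semiInv (H : FPartialGroup F) (a : H.SemiElt) : H.SemiElt :=
  ⟨(F.inv a.1.1, H.grp.inv ((H.act₁ a.1.2 [F.inv a.1.1]).get a.2)), by
    have h := (mem_act₁.1 (Part.get_mem a.2)).inv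
    exact dom_act₁.2 ⟨_, h.invH⟩⟩

/-- `1 = 1 ⋉ 1`. -/
def semiOne (H : FPartialGroup F) : H.SemiElt :=
  ⟨(F.one, H.grp.one), dom_act₁.2 ⟨_, Act.one_one (val_singleton _)⟩⟩

theorem semiInv_fst (a : H.SemiElt) : (H.semiInv a).1.1 = F.inv a.1.1 := rfl

theorem semiOne_fst : (H.semiOne).1.1 = F.one := rfl

theorem exists_semiInv (a : H.SemiElt) : ∃ e, H.Act [a.1.2] [F.inv a.1.1] [e] ∧
    (H.semiInv a).1 = (F.inv a.1.1, H.grp.inv e) :=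
  ⟨_, mem_act₁.1 (Part.get_mem a.2), rfl⟩

theorem semiInv_semiInv (a : H.SemiElt) : H.semiInv (H.semiInv a) = a := by
  obtain ⟨e, h1, h2⟩ := exists_semiInv a
  obtain ⟨e', h3, h4⟩ := exists_semiInv (H.semiInv a)
  rw [h2] at h3 h4
  have h5 := h1.inv.invH
  rw [invW_singleton] at h5
  have := h3.unique₁ h5
  subst this
  refine Subtype.ext ?_
  rw [h4]
  simp [inv_inv]

theorem fstW_append (α β : List H.SemiElt) : fstW (α ++ β) = fstW α ++ fstW β := by simp [fstW]

theorem fstW_cons (a : H.SemiElt) (α : List H.SemiElt) : fstW (a :: α) = a.1.1 :: fstW α := rfl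

theorem fstW_nil : fstW ([] : List H.SemiElt) = [] := rfl

theorem fstW_inv (α : List H.SemiElt) :
    fstW (α.map H.semiInv).reverse = F.invW (fstW α) := by
  simp [fstW, PartialGroup.invW, Function.comp_def, semiInv]

theorem TA.append {σ : List F} {α β : List H.SemiElt} {ξ : List H} :
    TA σ (α ++ β) ξ ↔ ∃ ξ₁ ξ₂, ξ = ξ₁ ++ ξ₂ ∧ TA (fstW β ++ σ) α ξ₁ ∧ TA σ β ξ₂ := by
  induction α generalizing ξ with
  | nil =>
    constructor
    · exact fun h => ⟨[], ξ, rfl, rfl, h⟩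
    · rintro ⟨ξ₁, ξ₂, rfl, h1, h2⟩
      rw [show ξ₁ = [] from h1]
      exact h2
  | cons a α ih =>
    constructor
    · rintro ⟨x, ζ, rfl, h1, h2⟩
      obtain ⟨ξ₁, ξ₂, rfl, h3, h4⟩ := ih.1 h2
      exact ⟨x :: ξ₁, ξ₂, rfl, ⟨x, ξ₁, rfl, by simpa [fstW_append] using h1, h3⟩, h4⟩
    · rintro ⟨_, ξ₂, rfl, ⟨x, ξ₁, rfl, h1, h3⟩, h4⟩
      exact ⟨x, ξ₁ ++ ξ₂, rfl, by simpa [fstW_append] using h1, ih.2 ⟨ξ₁, ξ₂, rfl, h3, h4⟩⟩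

theorem TA.mono {σ τ : List F} (h : ∀ l (a b : H), H.Act [a] (l ++ σ) [b] → H.Act [a] (l ++ τ) [b])
    {α : List H.SemiElt} {ξ : List H} (hα : TA σ α ξ) : TA τ α ξ := by
  induction α generalizing ξ with
  | nil => exact hα
  | cons a α ih =>
    obtain ⟨x, ζ, rfl, h1, h2⟩ := hα
    exact ⟨x, ζ, rfl, h _ _ _ h1, ih h2⟩

theorem TA.restrict {σ : List F} {α : List H.SemiElt} {ξ : List H} (h : TA σ α ξ) :
    ∃ ξ₀, TA [] α ξ₀ ∧ List.Forall₂ (fun a b => H.Act [a] σ [b]) ξ₀ ξ := by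
  induction α generalizing ξ with
  | nil =>
    rw [show ξ = [] from h]
    exact ⟨[], rfl, List.Forall₂.nil⟩
  | cons a α ih =>
    obtain ⟨x, ζ, rfl, h1, h2⟩ := h
    obtain ⟨ξ₀, h3, h4⟩ := ih h2
    obtain ⟨b, h5, h6⟩ := h1.split₁
    exact ⟨b :: ξ₀, ⟨b, ξ₀, rfl, by simpa using h5, h3⟩, List.Forall₂.cons h6 h4⟩

theorem TA.inverse {σ : List F} {α : List H.SemiElt} {ξ ζ : List H} (h : TA [] α ξ)
    (h' : List.Forall₂ (fun a b => H.Act [a] (F.invW (fstW α) ++ σ) [b]) ξ ζ) :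
    TA σ (α.map H.semiInv).reverse (H.grp.invW ζ) := by
  induction α generalizing ξ ζ σ with
  | nil =>
    rw [show ξ = [] from h] at h'
    cases h'
    exact rfl
  | cons a α ih =>
    obtain ⟨x, ξ, rfl, h1, h2⟩ := h
    cases h' with
    | @cons _ z _ ζ h3 h4 =>
      rw [List.map_cons, List.reverse_cons, TA.append]
      refine ⟨H.grp.invW ζ, [H.grp.inv z], invW_cons _ _, ?_, ?_⟩
      · refine ih (σ := fstW [H.semiInv a] ++ σ) h2 (h4.imp fun p q hq => ?_)
        rw [fstW_cons, invW_cons] at hq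
        simpa [fstW_cons, fstW_nil, semiInv_fst] using hq
      · refine ⟨_, [], rfl, ?_, rfl⟩
        obtain ⟨e, h5, h6⟩ := exists_semiInv a
        rw [h6]
        rw [List.append_nil] at h1
        rw [fstW_cons, invW_cons, List.append_assoc] at h3
        have h7 := h3.after h1.inv
        exact (h7.after h5).invH

theorem TA.extend {σ : List F} {α : List H.SemiElt} {ξ ζ : List H} (h : TA [] α ξ)
    (h' : List.Forall₂ (fun a b => H.Act [a] (F.invW (fstW α) ++ σ) [b]) ξ ζ) :
    TA (F.invW (fstW α) ++ σ) α ζ := by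
  induction α generalizing ξ ζ σ with
  | nil =>
    rw [show ξ = [] from h] at h'
    cases h'
    exact rfl
  | cons a α ih =>
    obtain ⟨x, ξ, rfl, h1, h2⟩ := h
    cases h' with
    | @cons _ z _ ζ h3 h4 =>
      rw [fstW_cons, invW_cons, List.append_assoc]
      rw [List.append_nil] at h1
      rw [fstW_cons, invW_cons, List.append_assoc] at h3
      refine ⟨z, ζ, rfl, ?_, ih h2 (h4.imp fun p q hq => ?_)⟩
      · rw [← List.append_assoc]
        exact Act.through h1 h3
      · rw [fstW_cons, invW_cons, List.append_assoc] at hq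
        exact hq

theorem semi_singleton (a : H.SemiElt) : a ∈ H.semiProd [a] := by
  obtain ⟨b, hb⟩ := dom_act₁.1 a.2
  refine mem_semiProd.2 ⟨[a.1.2], [b], ⟨_, [], rfl, ?_, rfl⟩, hb, val_singleton _, val_singleton _⟩
  exact Act.nil (by rw [H.grp.prod_singleton]; trivial)

theorem semi_insert_one (l r : List H.SemiElt) (h : H.SemiDom (l ++ r)) :
    H.SemiDom (l ++ [H.semiOne] ++ r) := by
  obtain ⟨ξ, ζ, h1, h2⟩ := semiDom_iff.1 h
  obtain ⟨ξ₁, ξ₂, rfl, h3, h4⟩ := TA.append.1 h1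
  obtain ⟨c, hc⟩ := exists_val_of_dom h.dom_fst
  rw [fstW_append] at hc h2
  obtain ⟨d, hd⟩ := val_right hc
  have h5 : TA [] ([H.semiOne] ++ r) ([H.grp.one] ++ ξ₂) :=
    ⟨_, _, rfl, Act.one_one (by simpa using hd), h4⟩
  have h6 : TA (fstW ([H.semiOne] ++ r) ++ []) l ξ₁ := by
    refine h3.mono fun w a b hab => ?_
    rw [List.append_nil] at hab
    simpa [fstW_cons, fstW_append, fstW_nil, semiOne_fst] using hab.insert_one
  have hl : ζ = ζ.take ξ₁.length ++ ζ.drop ξ₁.length := (List.take_append_drop _ _).symm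
  have hlen := h2.len
  rw [hl] at h2
  have h7 := h2.insertH (by simp at hlen ⊢; omega)
  rw [invW_append] at h7
  have h8 := h7.insert_one
  refine semiDom_iff.2 ⟨ξ₁ ++ ([H.grp.one] ++ ξ₂),
    ζ.take ξ₁.length ++ [H.grp.one] ++ ζ.drop ξ₁.length, ?_, ?_⟩
  · rw [List.append_assoc]
    exact TA.append.2 ⟨_, _, rfl, h6, h5⟩
  · rw [← List.append_assoc]
    have e : F.invW (fstW (l ++ [H.semiOne] ++ r)) =
        F.invW (fstW r) ++ [F.one] ++ F.invW (fstW l) := by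
      simp [fstW_append, fstW_cons, invW_append, invW_cons, semiOne_fst, inv_one]
    rw [e]
    exact h8

theorem semi_contract (l v r : List H.SemiElt) (y z : H.SemiElt) (hv : v ≠ [])
    (hy : y ∈ H.semiProd v) (hz : z ∈ H.semiProd (l ++ v ++ r)) :
    z ∈ H.semiProd (l ++ [y] ++ r) := by
  obtain ⟨ξ₀, -, h1, -, hc, hd⟩ := mem_semiProd.1 hy
  obtain ⟨ξ, ζ, h2, h3, hc', hd'⟩ := mem_semiProd.1 hz
  rw [List.append_assoc] at h2
  obtain ⟨ξ₁, ξ', rfl, h4, h5⟩ := TA.append.1 h2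
  obtain ⟨ξ₂, ξ₃, rfl, h6, h7⟩ := TA.append.1 h5
  rw [List.append_nil] at h6
  obtain ⟨ξ₀', h8, h9⟩ := h6.restrict
  rw [h8.unique h1] at h9
  have hn : ξ₂ ≠ [] := by
    rintro rfl
    have := h6.len
    simp at this
    exact hv (List.length_eq_zero_iff.1 this.symm)
  have hlen := h3.len
  have e : F.invW (fstW (l ++ v ++ r)) =
      F.invW (fstW r) ++ F.invW (fstW v) ++ F.invW (fstW l) := by
    simp [fstW_append, invW_append]
  rw [e] at h3
  have hζ : ζ = ζ.take ξ₁.length ++ (ζ.drop ξ₁.length).take ξ₂.length ++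
      ζ.drop (ξ₁.length + ξ₂.length) := by
    rw [List.append_assoc, ← List.drop_drop, List.take_append_drop, List.take_append_drop]
  rw [hζ, ← List.append_assoc] at h3
  have l1 : ξ₁.length = (ζ.take ξ₁.length).length := by simp at hlen ⊢; omega
  have l2 : ξ₂.length = ((ζ.drop ξ₁.length).take ξ₂.length).length := by simp at hlen ⊢; omega
  have h10 := h3.mid l1 l2 hn
  rw [List.append_assoc] at h10
  obtain ⟨t, h11, -⟩ := h10.split
  have h12 : List.Forall₂ (fun a b => H.Act [a] (F.invW (fstW r)) [b]) ξ₂ ξ₀ :=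
    List.Forall₂.flip (h9.imp fun a b hab => hab.inv)
  rw [forall₂_unique h11.forall₂ h12] at h11
  have h13 := h11.inv
  rw [invW_invW] at h13
  obtain ⟨d', h14, h15⟩ := Act.contractH (a := []) (c := []) (a' := []) (c' := []) rfl h13.len
    (ne_nil_of_dom h13.dom_left) hd (by simpa using h13)
  obtain ⟨d'', -, h16⟩ := h3.contractH l1 l2 hn h14
  have h17 := h16.contract (val_invW hc)
  refine mem_semiProd.2 ⟨ξ₁ ++ ([d'] ++ ξ₃),
    ζ.take ξ₁.length ++ [d''] ++ ζ.drop (ξ₁.length + ξ₂.length), ?_, ?_, ?_, ?_⟩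
  · rw [List.append_assoc]
    refine TA.append.2 ⟨_, _, rfl, ?_, ⟨d', ξ₃, rfl, by simpa using h15, h7⟩⟩
    refine h4.mono fun w a b hab => ?_
    have := Act.contract (l := w) (r := fstW r) hc (by simpa [fstW_append] using hab)
    simpa [fstW_cons] using this
  · rw [← List.append_assoc]
    have e' : F.invW (fstW (l ++ [y] ++ r)) =
        F.invW (fstW r) ++ [F.inv y.1.1] ++ F.invW (fstW l) := by
      simp [fstW_append, fstW_cons, invW_append, invW_cons]
    rw [e']
    exact h17
  · have := val_contract (l := fstW l) (r := fstW r) hc (by simpa [fstW_append] using hc')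
    simpa [fstW_append, fstW_cons, fstW_nil] using this
  · have := val_contract (l := ξ₁) (r := ξ₃) h14 (by simpa using hd')
    simpa using this

theorem semi_mul_inv (α : List H.SemiElt) (h : H.SemiDom α) :
    ∃ ξ, TA [] (α ++ (α.map H.semiInv).reverse) (ξ ++ H.grp.invW ξ) ∧
      H.Act (ξ ++ H.grp.invW ξ) (F.invW (fstW (α ++ (α.map H.semiInv).reverse)))
        (ξ ++ H.grp.invW ξ) := by
  obtain ⟨ξ, ζ, h1, h2⟩ := semiDom_iff.1 h
  refine ⟨ζ, TA.append.2 ⟨_, _, rfl, ?_, ?_⟩, ?_⟩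
  · rw [fstW_inv]
    exact h1.extend (by simpa using h2.forall₂)
  · exact h1.inverse (by simpa using h2.forall₂)
  · rw [fstW_append, fstW_inv, invW_append, invW_invW]
    have h3 := h2.inv
    rw [invW_invW] at h3
    exact h3.mulInv.mulInvH

theorem semi_invW_invW (α : List H.SemiElt) :
    ((α.map H.semiInv).reverse.map H.semiInv).reverse = α := by
  simp [Function.comp_def, semiInv_semiInv]

theorem semi_inv_dom (α : List H.SemiElt) (h : H.SemiDom α) :
    H.SemiDom (α.map H.semiInv).reverse := by
  obtain ⟨ξ, ζ, h1, h2⟩ := semiDom_iff.1 h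
  obtain ⟨ζ', h3, h4⟩ := semi_mul_inv α h
  obtain ⟨ξ₁, ξ₂, e, h5, h6⟩ := TA.append.1 h3
  have hl : ξ₁.length = ξ₂.length := by rw [h5.len, h6.len]; simp
  have hl' : ζ'.length = ξ₁.length := by
    have := congrArg List.length e
    simp only [List.length_append, invW_length] at this
    omega
  have hn : H.grp.invW ζ' ≠ [] := by
    have := ne_nil_of_dom h2.dom_left
    have h7 := List.length_pos_of_ne_nil this
    rw [h1.len, ← h5.len, ← hl', ← invW_length] at h7
    exact List.ne_nil_of_length_pos h7
  obtain ⟨e1, e2⟩ := List.append_inj e hl'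
  have h8 := h4.right rfl hn
  rw [fstW_append, invW_append] at h8
  obtain ⟨y, h9, -⟩ := h8.split
  rw [← e2] at h6
  exact semiDom_iff.2 ⟨_, y, h6, h9⟩

theorem semi_prod_mul_inv (a : H.SemiElt) : H.semiOne ∈ H.semiProd [a, H.semiInv a] := by
  obtain ⟨ζ, h1, h2⟩ := semi_mul_inv [a] (Part.dom_iff_mem.2 ⟨a, semi_singleton a⟩)
  obtain ⟨z, hz⟩ := exists_val_of_dom h2.dom_left
  refine mem_semiProd.2 ⟨ζ ++ H.grp.invW ζ, ζ ++ H.grp.invW ζ, h1, h2, ?_, ?_⟩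
  · exact Or.inr (by
      change _ ∈ F.prod [a.1.1, F.inv a.1.1]; rw [F.prod_mul_inv]; exact Part.mem_some _)
  · have := (le_mul_inv ζ).val hz
    rw [val_unique this val_nil] at hz
    exact hz

end semidirect

/-- The semidirect product `ℱ ⋉ ℋ`: its elements are the `γ ⋉ η` with `(η | γ⁻¹) ∈ ℋ₁ℱ₁`, a
sequence `α` of them lies in `(ℱ ⋉ ℋ)ₙ` if `A⁺(α) ∈ ℋₙℱₙ`, and
`∇(α) = ∇((γᵢ)ᵢ) ⋉ ∇(A(α))`. -/
def semidirect (F : PartialGroup.{u}) (H : FPartialGroup F) : PartialGroup.{u} where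
  carrier := H.SemiElt
  prod := H.semiProd
  one := H.semiOne
  inv := H.semiInv
  not_dom_nil h := by
    obtain ⟨x, _⟩ := id h
    exact ne_nil_of_dom x.2.2 (List.length_eq_zero_iff.1 x.2.1)
  prod_singleton a := Part.eq_some_iff.2 (semi_singleton a)
  dom_tail a w hw h := by
    obtain ⟨ξ, ζ, ⟨x, ξ, rfl, h1, h2⟩, h3⟩ := semiDom_iff.1 h
    rw [fstW_cons, invW_cons] at h3
    obtain ⟨y, h4, -⟩ := h3.split
    have hn : ξ ≠ [] := by
      rintro rfl
      exact hw (List.length_eq_zero_iff.1 h2.len.symm)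
    cases y with
    | nil => exact absurd rfl (ne_nil_of_dom h4.dom_right)
    | cons b y => exact semiDom_iff.2 ⟨ξ, y, h2, h4.tail hn⟩
  dom_init w a hw h := by
    obtain ⟨_, ζ, h1, h2⟩ := semiDom_iff.1 h
    obtain ⟨ξ, _, rfl, h3, ⟨x, ξ', rfl, h4, h5⟩⟩ := TA.append.1 h1
    rw [show ξ' = [] from h5] at h2
    have hn : ξ ≠ [] := by
      rintro rfl
      exact hw (List.length_eq_zero_iff.1 h3.len.symm)
    obtain ⟨ξ₀, h6, h7⟩ := h3.restrict
    rcases List.eq_nil_or_concat ζ with rfl | ⟨ζ, b, rfl⟩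
    · exact absurd rfl (ne_nil_of_dom h2.dom_right)
    · rw [List.concat_eq_append] at h2
      have h8 := h2.init hn
      rw [fstW_append, invW_append] at h8
      obtain ⟨y, h9, h10⟩ := h8.split
      have h11 : List.Forall₂ (fun p q => H.Act [p] (F.invW (fstW [a])) [q]) ξ ξ₀ :=
        List.Forall₂.flip (h7.imp fun p q hpq => by
          rw [List.append_nil] at hpq; exact hpq.inv)
      rw [forall₂_unique h9.forall₂ h11] at h10
      exact semiDom_iff.2 ⟨ξ₀, ζ, h6, h10⟩
  prod_contract l v r y hv hy h :=
    Part.eq_of_dom_of_mem h fun z hz => semi_contract l v r y z hv hy hz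
  dom_insert_one := semi_insert_one
  prod_one_left a := by
    have hd : H.SemiDom [a] := Part.dom_iff_mem.2 ⟨a, semi_singleton a⟩
    obtain ⟨_, ζ, ⟨x, _, rfl, h1, ⟨y, _, rfl, h2, h3⟩⟩, h4⟩ :=
      semiDom_iff.1 (semi_insert_one [] [a] hd)
    refine Part.eq_some_iff.2 (mem_semiProd.2 ⟨_, ζ, ⟨x, _, rfl, h1, ⟨y, _, rfl, h2, h3⟩⟩, h4,
      ?_, ?_⟩)
    · exact Or.inr (by
        change _ ∈ F.prod [F.one, a.1.1]; rw [F.prod_one_left]; exact Part.mem_some _)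
    · have e1 := h1.unique₁ (Act.one_one h1.val.choose_spec)
      have e2 := h2.unique₁ (Act.nil (by rw [H.grp.prod_singleton]; trivial))
      rw [e1, e2, show _ = [] from h3]
      exact Or.inr (by rw [H.grp.prod_one_left]; exact Part.mem_some _)
  prod_one_right a := by
    have hd : H.SemiDom ([a] ++ []) := Part.dom_iff_mem.2 ⟨a, semi_singleton a⟩
    obtain ⟨_, ζ, ⟨x, _, rfl, h1, ⟨y, _, rfl, h2, h3⟩⟩, h4⟩ :=
      semiDom_iff.1 (semi_insert_one [a] [] hd)
    refine Part.eq_some_iff.2 (mem_semiProd.2 ⟨_, ζ, ⟨x, _, rfl, h1, ⟨y, _, rfl, h2, h3⟩⟩, h4,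
      ?_, ?_⟩)
    · exact Or.inr (by
        change _ ∈ F.prod [a.1.1, F.one]; rw [F.prod_one_right]; exact Part.mem_some _)
    · have e1 : x = a.1.2 := by
        have := Act.act_one_eq (a := F.one) rfl h1
        simpa using this
      have e2 := h2.unique₁ (Act.nil (by rw [H.grp.prod_singleton]; trivial))
      rw [e1, e2, show _ = [] from h3]
      exact Or.inr (by rw [show (H.semiOne).1.2 = H.grp.one from rfl, H.grp.prod_one_right]
                       exact Part.mem_some _)
  dom_mul_inv α h := by
    obtain ⟨ξ, h1, h2⟩ := semi_mul_inv α h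
    exact semiDom_iff.2 ⟨_, _, h1, h2⟩
  dom_inv_mul α h := by
    have h1 := semi_inv_dom α h
    obtain ⟨ξ, h2, h3⟩ := semi_mul_inv _ h1
    rw [semi_invW_invW] at h2 h3
    exact semiDom_iff.2 ⟨_, _, h2, h3⟩
  prod_mul_inv a := Part.eq_some_iff.2 (semi_prod_mul_inv a)
  prod_inv_mul a := by
    have := semi_prod_mul_inv (H.semiInv a)
    rw [semiInv_semiInv] at this
    exact Part.eq_some_iff.2 this

end FPartialGroup

/-! ### Padding sequences with units -/

namespace PartialGroup

variable {P : PartialGroup.{u}}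

/-! Everything rests on the factorisation γ ⋉ η = ι(γ) h(η) in ℱ ⋉ ℋ (`mem_prod_inl_inr`). It forces
ψ(γ ⋉ η) = φ(γ) f(η), so ψ is unique. What remains is to see that ι and h are maps of the required
kinds, and that this formula defines a map of partial groups.

For ι and h as maps of partial groups: a unit of ℋ is fixed by every sequence of ℱ that can be
multiplied, and units of ℱ act trivially. Hence A(ι(γ₁), …, ι(γₙ)) = (1, …, 1) and A(h(η₁), …,
h(ηₙ)) = (η₁, …, ηₙ).

For the equivariance of h, let ζ = ◁(ξ | γ) with ξ of length r. Conjugating h(ξ) by ι(γ) gives a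
sequence whose ℱ-part is γ⁻¹ × (1) × γ repeated r times, and whose A is ζ with units inserted around
its entries (`TA.conjW_inl`). The ℱ-part equals its own inverse sequence and fixes ζ, because γ may
be replaced by γ × γ⁻¹ × γ and units may be inserted (`Act.append_conjW_replicate_one`). So the
conjugated sequence can be multiplied, and each block has product 1 ⋉ ζⱼ.

For ψ, let α = (γᵢ ⋉ ηᵢ)ᵢ be a sequence that can be multiplied, let ξ = A(α), and let ζ = ◁(ξ |
γₙ⁻¹, …, γ₁⁻¹), so that ξ = ◁(ζ | γ) for γ = (γ₁, …, γₙ). Since (ζ | γ × γ⁻¹) is defined, the map f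
shows that φ(γ), followed by the conjugates of the f(ζⱼ) by φ(γ), can be multiplied. This one
sequence reduces in two ways. Multiplying out the conjugates gives φ(γ) × f(ξ), hence ψ(∇α). Peeling
off one γᵢ at a time, with cancellation of the rest of φ(γ), gives (ψ(α₁), …, ψ(αₙ))
(`le_map_liftFun`). A reduction preserves the product, so ψ respects products. -/

theorem invW_replicate_one (n : ℕ) :
    P.invW (List.replicate n P.one) = List.replicate n P.one := by
  simp [invW, inv_one]

theorem le_insert_replicate_one (n : ℕ) : P.Le [] (List.replicate n P.one) := by
  induction n with
  | zero => exact Le.refl _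
  | succ n ih => rw [List.replicate_succ]; exact le_insert_one.append ih

end PartialGroup

namespace FPartialGroup

variable {F : PartialGroup.{u}} {H : FPartialGroup F}

namespace Act

variable {ξ ζ : List H} {δ : List F}

theorem insert_replicate_one (n : ℕ) {l r : List F} (h : H.Act ξ (l ++ r) ζ) :
    H.Act ξ (l ++ List.replicate n F.one ++ r) ζ := by
  induction n with
  | zero => simpa using h
  | succ n ih =>
    have h1 := (show H.Act ξ (l ++ (List.replicate n F.one ++ r)) ζ by simpa using ih).insert_one
    simpa [List.replicate_succ] using h1

theorem replicate_one (h : (H.grp.prod ξ).Dom) (n : ℕ) :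
    H.Act ξ (List.replicate n F.one) ξ := by
  simpa using insert_replicate_one n (l := []) (r := []) (by simpa using nil h)

theorem insertH_replicate_one (n : ℕ) {a c a' c' : List H} (ha : a.length = a'.length)
    (h : H.Act (a ++ c) δ (a' ++ c')) :
    H.Act (a ++ List.replicate n H.grp.one ++ c) δ
      (a' ++ List.replicate n H.grp.one ++ c') := by
  induction n with
  | zero => simpa using h
  | succ n ih =>
    have h1 := insertH (c := List.replicate n H.grp.one ++ c)
      (c' := List.replicate n H.grp.one ++ c') ha (by simpa using ih)
    simpa [List.replicate_succ] using h1

/-- Conjugating formally by a sequence of units only inserts units between the entries of `ξ`, and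
insertion of a unit is a map of ℱ-sets. -/
theorem conjW_replicate_one (n : ℕ) (h : H.Act ξ δ ξ) :
    H.Act (H.grp.conjW (List.replicate n H.grp.one) ξ) δ
      (H.grp.conjW (List.replicate n H.grp.one) ξ) := by
  -- The action is defined on whole sequences, and knowing it on the parts would not be enough. The
  -- induction therefore carries along the part `a` that is already padded.
  suffices key : ∀ a : List H, H.Act (a ++ ξ) δ (a ++ ξ) →
      H.Act (a ++ H.grp.conjW (List.replicate n H.grp.one) ξ) δ
        (a ++ H.grp.conjW (List.replicate n H.grp.one) ξ) from key [] h
  clear h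
  induction ξ with
  | nil => exact fun a h => h
  | cons x ξ ih =>
    intro a h
    have h1 := insertH_replicate_one n rfl h
    have h2 := insertH_replicate_one n (a := a ++ List.replicate n H.grp.one ++ [x])
      (c := ξ) (c' := ξ) rfl (by simpa using h1)
    have h3 := ih _ h2
    simpa [conjW_cons, blockW, invW_replicate_one] using h3

/-- If `(ξ | δ)` is defined, then `δ` may be followed by `δ⁻¹ × (1) × δ` any number of times. -/
theorem append_conjW_replicate_one (h : H.Act ξ δ ζ) (k : ℕ) :
    H.Act ξ (δ ++ F.conjW δ (List.replicate k F.one)) ζ := by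
  induction k with
  | zero => simpa [conjW_nil] using h
  | succ k ih =>
    -- The leading δ becomes δ × δ⁻¹ × δ without changing the value, and a unit goes between δ⁻¹ and
    -- the second δ.
    have h1 := insert_one (l := δ ++ F.invW δ)
      (r := δ ++ F.conjW δ (List.replicate k F.one)) (by simpa using ih.triple)
    simpa [List.replicate_succ, conjW_cons, blockW] using h1

/-- Once δ has carried `ξ` to `ζ`, the blocks appended to δ act on `ζ`, and they do not change the
value. -/
theorem act_conjW_replicate_one (h : H.Act ξ δ ζ) (k : ℕ) :
    H.Act ζ (F.conjW δ (List.replicate k F.one)) ζ :=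
  (h.append_conjW_replicate_one k).after h

end Act

/-! ### The maps ι and h of partial groups -/

/-- The element `γ ⋉ 1`. -/
def inlElt (H : FPartialGroup F) (γ : F) : H.SemiElt :=
  ⟨(γ, H.grp.one), dom_act₁.2 ⟨_, Act.one_one (val_singleton _)⟩⟩

/-- The element `1 ⋉ η`. -/
def inrElt (H : FPartialGroup F) (η : H) : H.SemiElt :=
  ⟨(F.one, η), dom_act₁.2 ⟨η, by
    change H.Act [η] [F.inv F.one] [η]
    rw [inv_one]
    exact Act.replicate_one (by rw [H.grp.prod_singleton]; trivial) 1⟩⟩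

theorem inrElt_fst (η : H) : (H.inrElt η).1.1 = F.one := rfl

theorem inrElt_snd (η : H) : (H.inrElt η).1.2 = η := rfl

theorem fstW_map_inlElt (w : List F) : fstW (w.map H.inlElt) = w := by
  simp [fstW, inlElt, Function.comp_def]

theorem fstW_map_inrElt (ξ : List H) :
    fstW (ξ.map H.inrElt) = List.replicate ξ.length F.one := by
  simp [fstW, inrElt, Function.comp_def]

/-- Every final segment of a sequence that can be multiplied can be multiplied, so it acts on 1 and
fixes it. -/
theorem TA.map_inlElt {σ w : List F} {c : F} (h : F.Val (w ++ σ) c) :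
    TA σ (w.map H.inlElt) (List.replicate w.length H.grp.one) := by
  induction w generalizing c with
  | nil => exact rfl
  | cons a w ih =>
    obtain ⟨d, hd⟩ := val_right (l := [a]) h
    exact ⟨_, _, rfl, Act.one_one (by rw [fstW_map_inlElt]; exact hd), ih hd⟩

/-- Each entry is acted on by units only, so it stays unchanged. -/
theorem TA.map_inrElt (ξ : List H) : TA [] (ξ.map H.inrElt) ξ := by
  induction ξ with
  | nil => exact rfl
  | cons x ξ ih =>
    refine ⟨x, ξ, rfl, ?_, ih⟩
    rw [fstW_map_inrElt, List.append_nil]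
    exact Act.replicate_one (by change (H.grp.prod [x]).Dom; rw [H.grp.prod_singleton]; trivial) _

theorem inlElt_mem_semiProd {w : List F} {z : F} (hz : z ∈ F.prod w) :
    H.inlElt z ∈ H.semiProd (w.map H.inlElt) := by
  have hv := val_of_mem hz
  refine mem_semiProd.2 ⟨_, List.replicate w.length H.grp.one,
    TA.map_inlElt (by simpa using hv), ?_, ?_, ?_⟩
  · rw [fstW_map_inlElt]
    obtain ⟨a, w', rfl⟩ := List.exists_cons_of_ne_nil (ne_nil_of_mem hz)
    -- The axiom on (1 | γ) concerns the one-term sequence (1). The other n - 1 units are inserted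
    -- equivariantly, which uses that `w` is non-empty.
    have := Act.insertH_replicate_one w'.length (a := [H.grp.one]) (c := []) rfl
      (by simpa using Act.one_one (H := H) (val_invW hv))
    simpa [List.replicate_succ] using this
  · rw [fstW_map_inlElt]; exact hv
  · exact (le_insert_replicate_one _).val val_nil

theorem inrElt_mem_semiProd {w : List H} {z : H} (hz : z ∈ H.grp.prod w) :
    H.inrElt z ∈ H.semiProd (w.map H.inrElt) := by
  refine mem_semiProd.2 ⟨w, w, TA.map_inrElt w, ?_, ?_, val_of_mem hz⟩
  · rw [fstW_map_inrElt, invW_replicate_one]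
    exact Act.replicate_one (Part.dom_iff_mem.2 ⟨z, hz⟩) _
  · rw [fstW_map_inrElt]
    exact (le_insert_replicate_one _).val val_nil

/-- The map `γ ↦ γ ⋉ 1` of partial groups. -/
def inl (H : FPartialGroup F) : PartialGroup.Hom F (semidirect F H) where
  toFun := H.inlElt
  map_prod _ _ := inlElt_mem_semiProd

/-- The map `η ↦ 1 ⋉ η` of partial groups. -/
def inrHom (H : FPartialGroup F) : PartialGroup.Hom H.grp (semidirect F H) where
  toFun := H.inrElt
  map_prod _ _ := inrElt_mem_semiProd

/-! ### Equivariance of h: conjugation by ι(γ) -/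

theorem blockW_inl (γ : List F) (x : H) :
    (semidirect F H).blockW (γ.map H.inl) (H.inrHom x) =
      (F.invW γ).map H.inlElt ++ [H.inrElt x] ++ γ.map H.inlElt := by
  rw [blockW, ← H.inl.map_invW]
  rfl

theorem fstW_blockW_inl (γ : List F) (x : H) :
    fstW ((semidirect F H).blockW (γ.map H.inl) (H.inrHom x)) = F.blockW γ F.one := by
  rw [blockW_inl, fstW_append, fstW_append, fstW_map_inlElt, fstW_map_inlElt]
  rfl

theorem fstW_conjW_inl (γ : List F) (ξ : List H) :
    fstW ((semidirect F H).conjW (γ.map H.inl) (ξ.map H.inrHom)) =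
      F.conjW γ (List.replicate ξ.length F.one) := by
  induction ξ with
  | nil => rfl
  | cons x ξ ih =>
    rw [List.map_cons, conjW_cons, List.length_cons, List.replicate_succ, conjW_cons, ← ih,
      ← fstW_blockW_inl γ x]
    exact fstW_append _ _

/-- This computes A of the conjugated sequence. To the right of h(ξⱼ) stands γ, followed by one
block γ⁻¹ × (1) × γ for each later entry. The first γ turns ξⱼ into ζⱼ and the later blocks fix it,
while the entries from ι(γ) and its inverse contribute units. -/
theorem TA.conjW_inl {γ : List F} {ξ ζ : List H}
    (h : List.Forall₂ (fun x y => H.Act [x] γ [y]) ξ ζ) :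
    TA [] ((semidirect F H).conjW (γ.map H.inl) (ξ.map H.inrHom))
      (H.grp.conjW (List.replicate γ.length H.grp.one) ζ) := by
  induction h with
  | nil => exact rfl
  | @cons x y ξ ζ h _ ih =>
    rw [List.map_cons, conjW_cons, conjW_cons]
    refine TA.append.2 ⟨_, _, rfl, ?_, ih⟩
    rw [fstW_conjW_inl, List.append_nil, blockW_inl, blockW, invW_replicate_one]
    -- A sequence that acts on something can be multiplied in ℱ. This supplies the products needed
    -- for the action on the units from both copies of γ in the first block; `hd` is the final
    -- segment that starts with the right-hand copy.
    obtain ⟨c, hc⟩ := (h.act_conjW_replicate_one (ξ.length + 1)).val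
    rw [List.replicate_succ, conjW_cons, blockW] at hc
    simp only [List.append_assoc] at hc ⊢
    obtain ⟨d, hd⟩ := val_right (l := F.invW γ ++ [F.one]) (by simpa using hc)
    refine TA.append.2 ⟨List.replicate γ.length H.grp.one, _, rfl, ?_, ?_⟩
    · have := TA.map_inlElt (H := H) hc
      rw [invW_length] at this
      simpa [fstW_append, fstW_cons, fstW_map_inlElt, inrElt_fst] using this
    · refine ⟨y, _, rfl, ?_, TA.map_inlElt hd⟩
      have := h.append_conjW_replicate_one ξ.length
      simpa [fstW_map_inlElt, inrElt_snd] using this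

/-- Because 1⁻¹ = 1, the repeated block γ⁻¹ × (1) × γ is its own inverse sequence. It fixes ζ, hence
also ζ with units inserted. Together with `TA.conjW_inl` this is the membership condition of ℱ ⋉ ℋ
for the conjugated sequence. -/
theorem Act.semiAct_conjW_inl {γ : List F} {ξ ζ : List H} (h : H.Act ξ γ ζ) :
    H.Act (H.grp.conjW (List.replicate γ.length H.grp.one) ζ)
      (F.invW (fstW ((semidirect F H).conjW (γ.map H.inl) (ξ.map H.inrHom))))
      (H.grp.conjW (List.replicate γ.length H.grp.one) ζ) := by
  rw [fstW_conjW_inl, ← conjW_invW, invW_replicate_one]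
  exact (h.act_conjW_replicate_one _).conjW_replicate_one _

/-- The map `η ↦ 1 ⋉ η` of `ℱ`-partial groups `ℋ → (ℱ ⋉ ℋ)^ι`. -/
def inr (H : FPartialGroup F) : Hom H (conj H.inl) where
  hom := H.inrHom
  isMap n x w y hw hy := by
    have h := act_iff.2 hy
    refine PAction.mem_pullback.2 ⟨fun _ => (H.action n).dom_sub x w hw (Part.dom_iff_mem.2 ⟨y, hy⟩),
      mem_adAct.2 ⟨semiDom_iff.2 ⟨_, _, TA.conjW_inl h.forall₂, h.semiAct_conjW_inl⟩, ?_⟩⟩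
    refine List.forall₂_map_left_iff.2 (List.forall₂_map_right_iff.2
      (h.forall₂.imp fun a b hab => Or.inr ?_))
    -- The case of a single entry describes one block: its ℱ-part γ⁻¹ × (1) × γ has product 1, and
    -- its A consists of `b` between units and has product `b`.
    have h1 := TA.conjW_inl (List.Forall₂.cons hab List.Forall₂.nil)
    have h2 := hab.semiAct_conjW_inl
    rw [← conjW_singleton]
    refine mem_semiProd.2 ⟨_, _, h1, h2, ?_, ?_⟩
    · have h3 := fstW_conjW_inl w [a]
      obtain ⟨c, hc⟩ := hab.val
      have h4 : F.Val (F.blockW w F.one) F.one := val_insert_one (exists_val_inv_mul hc)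
      rw [← conjW_singleton] at h4
      exact h3.symm ▸ h4
    · rw [conjW_singleton, blockW, invW_replicate_one]
      have h3 := ((le_insert_replicate_one (P := H.grp) w.length).right [b]).append
        (le_insert_replicate_one w.length)
      exact h3.val (val_singleton b)

/-! ### The factorisation γ ⋉ η = ι(γ) h(η) -/

/-- Here A(γ ⋉ 1, 1 ⋉ η) = (1, η), and it has to be acted on by (1, γ⁻¹). This is obtained from (η |
γ⁻¹), which is defined by the choice of elements of ℱ ⋉ ℋ, by inserting one unit in ℋ and one in ℱ.
-/
theorem mem_prod_inl_inr (x : H.SemiElt) :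
    x ∈ (semidirect F H).prod [H.inl x.1.1, H.inrHom x.1.2] := by
  obtain ⟨b, hb⟩ := dom_act₁.1 x.2
  refine mem_semiProd.2 ⟨[H.grp.one, x.1.2], [H.grp.one, b], ⟨_, _, rfl,
    Act.one_one (val_singleton F.one), _, _, rfl, ?_, rfl⟩, ?_, ?_, ?_⟩
  · exact Act.nil (by rw [H.grp.prod_singleton]; trivial)
  · have h1 := Act.insert_one (l := []) (r := [F.inv x.1.1])
      (Act.insertH (a := []) (c := [x.1.2]) (a' := []) (c' := [b]) rfl hb)
    have e : F.invW (fstW [H.inlElt x.1.1, H.inrElt x.1.2]) = [F.one, F.inv x.1.1] := by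
      change [F.inv F.one, F.inv x.1.1] = _
      rw [inv_one]
    exact e ▸ h1
  · exact Or.inr (by
      change _ ∈ F.prod [x.1.1, F.one]; rw [F.prod_one_right]; exact Part.mem_some _)
  · exact Or.inr (by rw [H.grp.prod_one_left]; exact Part.mem_some _)

/-! ### The induced map ψ -/

section lift

variable {P : PartialGroup.{u}} {φ : PartialGroup.Hom F P}

/-- A map of `ℱ`-partial groups `ℋ → 𝒫^φ`, as a map of partial groups `ℋ → 𝒫`. -/
def Hom.toGrp (f : Hom H (conj φ)) : PartialGroup.Hom H.grp P := f.hom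

/-- This unfolds what equivariance of `f` means in 𝒫^φ: the conjugated sequence can be multiplied as
a whole, and each block has the expected product. -/
theorem Act.map_conj (f : Hom H (conj φ)) {ξ ζ : List H} {δ : List F} (h : H.Act ξ δ ζ) :
    (P.prod (P.conjW (δ.map φ) (ξ.map f.toGrp))).Dom ∧
      List.Forall₂ (fun p q => P.Val (P.blockW (δ.map φ) p) q) (ξ.map f.toGrp) (ζ.map f.toGrp) := by
  obtain ⟨n, x, y, rfl, rfl, hxy⟩ := h
  -- Maps of ℱ-sets are only constrained on non-empty δ; for empty δ the conjugated sequence is the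
  -- image of ξ itself.
  by_cases hn : δ = []
  · subst hn
    rw [PAction.act_nil, Part.mem_some_iff] at hxy
    subst hxy
    rw [List.map_nil, conjW_nil_left]
    exact ⟨(Word.map f.toGrp y).2.2, List.forall₂_same.2 fun p _ => val_singleton p⟩
  · exact mem_adAct.1 (PAction.mem_pullback.1 (f.isMap n x δ y hn hxy)).2

theorem Act.map_blockW (f : Hom H (conj φ)) {a b : H} {δ : List F} (h : H.Act [a] δ [b]) :
    P.Val (P.blockW (δ.map φ) (f.toGrp a)) (f.toGrp b) := by
  cases (h.map_conj f).2 with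
  | cons h _ => exact h

/-- As (η | γ⁻¹) is defined, f makes (φ(γ), f(η), φ(γ)⁻¹) a sequence with a product; its last entry
is dropped. -/
theorem dom_lift (f : Hom H (conj φ)) (x : H.SemiElt) : (P.prod [φ x.1.1, f.toGrp x.1.2]).Dom := by
  obtain ⟨b, hb⟩ := dom_act₁.1 x.2
  have h := hb.map_blockW f
  have e : P.blockW ([F.inv x.1.1].map φ) (f.toGrp x.1.2) =
      [φ x.1.1, f.toGrp x.1.2] ++ [P.inv (φ x.1.1)] := by
    simp [blockW, invW_singleton, φ.map_inv, inv_inv]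
  rw [e] at h
  obtain ⟨y, hy⟩ := val_left h
  exact dom_of_val (by simp) hy

/-- The map `γ ⋉ η ↦ φ(γ) f(η)`. -/
def liftFun (f : Hom H (conj φ)) (x : H.SemiElt) : P :=
  (P.prod [φ x.1.1, f.toGrp x.1.2]).get (dom_lift f x)

theorem liftFun_mem (f : Hom H (conj φ)) (x : H.SemiElt) :
    liftFun f x ∈ P.prod [φ x.1.1, f.toGrp x.1.2] :=
  Part.get_mem _

/-- Let γ' be the tail of (γ₁, …, γₙ). In φ(γ₁) × φ(γ') followed by the first conjugate φ(γ')⁻¹ ×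
φ(p × γ₁)⁻¹ × f(ζ₁) × φ(p × γ₁) × φ(γ'), the inner φ(γ') × φ(γ')⁻¹ cancels. What is left of the
conjugate, up to its last factor φ(γ'), multiplies to f(η₁), so φ(γ₁) f(η₁) = ψ(γ₁ ⋉ η₁) splits off.
The remaining φ(γ') stands in front of the other conjugates, ready for the induction. The prefix `p`
records the γᵢ already split off; these still occur in the later conjugates. -/
theorem le_map_liftFun (f : Hom H (conj φ)) {α : List H.SemiElt} {ξ ζ : List H} {p : List F}
    (hα : TA [] α ξ) (h : List.Forall₂ (fun z x => H.Act [z] (p ++ fstW α) [x]) ζ ξ) :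
    P.Le ((fstW α).map φ ++ P.conjW ((p ++ fstW α).map φ) (ζ.map f.toGrp)) (α.map (liftFun f)) := by
  induction α generalizing ξ ζ p with
  | nil =>
    rw [show ξ = [] from hα] at h
    cases h
    exact Le.refl _
  | cons a α ih =>
    obtain ⟨x, ξ, rfl, h1, h2⟩ := hα
    rw [List.append_nil] at h1
    cases h with
    | @cons z _ ζ _ h3 h4 =>
      have e : p ++ fstW (a :: α) = p ++ [a.1.1] ++ fstW α := by simp [fstW_cons]
      rw [e] at h3 ⊢
      simp only [e] at h4
      have ih := ih h2 h4
      obtain ⟨b, h5, h6⟩ := h3.split₁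
      -- Both ◁(ζ₁ | p, γ₁) and η₁ are carried to ξ₁ by γ', and the inverse of γ' brings ξ₁ back to
      -- only one element.
      obtain rfl := h6.inv.unique₁ h1.inv
      have h7 := h5.map_blockW f
      have h8 := ((le_mul_inv ((fstW α).map φ)).left [φ a.1.1]).right
        (P.blockW ((p ++ [a.1.1]).map φ) (f.toGrp z))
      have h9 := h8.trans ((le_of_val h7).left [φ a.1.1])
      have h10 := h9.trans (le_of_val (val_of_mem (liftFun_mem f a)))
      have h11 := h10.append ih
      simpa [conjW_cons, blockW, fstW_cons, invW_append, invW_cons _ ((fstW α).map φ),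
        invW_singleton] using h11

/-- The sequence φ(γ) × (conjugates of the f(ζⱼ) by φ(γ)) can be multiplied, and it reduces both to
(ψ(α₁), …, ψ(αₙ)) and to (φ(∇γ), f(∇ξ)), so the two have the same product. -/
theorem liftFun_mem_prod (f : Hom H (conj φ)) {α : List H.SemiElt} {z : H.SemiElt}
    (hz : z ∈ H.semiProd α) : liftFun f z ∈ P.prod (α.map (liftFun f)) := by
  obtain ⟨ξ, ζ, h1, h2, h3, h4⟩ := mem_semiProd.1 hz
  have h5 := h2.inv
  rw [invW_invW] at h5
  -- Conjugation by γ alone would not supply the factor φ(γ) on the left. Conjugating by γ × γ⁻¹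
  -- does: between neighbouring entries the outer factors cancel, leaving φ(γ) at the left end and
  -- φ(γ)⁻¹ at the right end, and the latter is dropped.
  obtain ⟨hd, -⟩ := h5.mulInv.map_conj f
  have hζ : ζ.map f.toGrp ≠ [] := by simpa using ne_nil_of_dom h2.dom_right
  obtain ⟨c, hc⟩ := exists_val_of_dom hd
  rw [List.map_append] at hc
  have h6 := (le_conjW_append _ _ hζ).val hc
  rw [φ.map_invW, invW_invW] at h6
  obtain ⟨d, h7⟩ := val_left h6
  have h8 := (le_map_liftFun (p := []) f h1 h5.forall₂).val (by simpa using h7)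
  -- The second reduction: the conjugate of f(ζⱼ) by φ(γ) has product f(ξⱼ), and then the φ-part and
  -- the f-part are multiplied separately.
  have h9 := ((le_conjW_contract (h5.map_conj f).2).left _).val h7
  have h10 := ((le_of_val (φ.map_val h3)).append (le_of_val (f.toGrp.map_val h4))).val h9
  rw [val_unique h10 (val_of_mem (liftFun_mem f z))] at h8
  exact mem_of_val (mt List.map_eq_nil_iff.1 (ne_nil_of_mem (P := semidirect F H) hz)) h8

/-- The map `ℱ ⋉ ℋ → 𝒫` induced by `φ : ℱ → 𝒫` and `f : ℋ → 𝒫^φ`. -/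
def lift (f : Hom H (conj φ)) : PartialGroup.Hom (semidirect F H) P where
  toFun := liftFun f
  map_prod _ _ := liftFun_mem_prod f

theorem lift_inl (f : Hom H (conj φ)) (γ : F) : lift f (H.inl γ) = φ γ := by
  have h : liftFun f (H.inlElt γ) ∈ P.prod [φ γ, f.toGrp H.grp.one] :=
    liftFun_mem f (H.inlElt γ)
  rw [f.toGrp.map_one, P.prod_one_right] at h
  exact Part.mem_some_iff.1 h

theorem lift_inr (f : Hom H (conj φ)) (η : H) : lift f (H.inrHom η) = f η := by
  have h : liftFun f (H.inrElt η) ∈ P.prod [φ F.one, f.toGrp η] :=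
    liftFun_mem f (H.inrElt η)
  rw [φ.map_one, P.prod_one_left] at h
  exact Part.mem_some_iff.1 h

/-- The value at γ ⋉ η is forced, since γ ⋉ η = ι(γ) h(η) and ψ respects this product. -/
theorem lift_unique (f : Hom H (conj φ)) (ψ : PartialGroup.Hom (semidirect F H) P)
    (h1 : ∀ γ : F, ψ (H.inl γ) = φ γ) (h2 : ∀ η : H, ψ (H.inrHom η) = f η) : ψ = lift f := by
  refine PartialGroup.Hom.ext (funext fun x => ?_)
  have h := ψ.map_prod _ _ (mem_prod_inl_inr x)
  simp only [List.map_cons, List.map_nil, h1, h2] at h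
  exact Part.mem_unique h (liftFun_mem f x)

end lift

/-! ### The universal arrow -/

/-- `η ↦ 1 ⋉ η`, as a morphism from `ℋ` to the value of `Φ` at `ι`. -/
def unit (H : FPartialGroup F) :
    H ⟶ (Phi F).obj (Under.mk (H.inl : F ⟶ semidirect F H)) := H.inr

/-- `ℱ ⋉ ℋ` is a universal arrow from `ℋ` to `Φ`. -/
def isInitialUnit (H : FPartialGroup F) : Limits.IsInitial (StructuredArrow.mk H.unit) :=
  Limits.IsInitial.ofUniqueHom
    -- An object `Y` amounts to a map φ : ℱ → 𝒫 together with f : ℋ → 𝒫^φ. A morphism to it is a map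
    -- ψ with ψ ∘ ι = φ (the condition in the category under ℱ) and ψ ∘ h = f (the condition for
    -- structured arrows).
    (fun Y => StructuredArrow.homMk
      (Under.homMk (lift (φ := Y.right.hom) Y.hom : semidirect F H ⟶ Y.right.right)
        (PartialGroup.Hom.ext (funext (lift_inl (φ := Y.right.hom) Y.hom))))
      (FPartialGroup.Hom.ext (PartialGroup.Hom.ext
        (funext (lift_inr (φ := Y.right.hom) Y.hom)))))
    fun Y m => by
      refine StructuredArrow.hom_ext _ _ (Under.UnderMorphism.ext ?_)
      refine lift_unique (φ := Y.right.hom) Y.hom m.right.right (fun γ => ?_) (fun η => ?_)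
      · exact congrArg (fun k : PartialGroup.Hom F Y.right.right => k γ) (Under.w m.right)
      · exact congrArg (fun k : Hom H (conj Y.right.hom) => k η) (StructuredArrow.w m)

end FPartialGroup

theorem theorem11p2 (F : PartialGroup.{u}) (H : FPartialGroup F) :
    ∃ (ι : F ⟶ FPartialGroup.semidirect F H)
      (h : H ⟶ (FPartialGroup.Phi F).obj (Under.mk ι)),
      (∀ γ : F, (PartialGroup.Hom.toFun ι γ : H.SemiElt).1 = (γ, H.grp.one)) ∧
      (∀ η : H, ((FPartialGroup.Hom.hom h) η : H.SemiElt).1 = (F.one, η)) ∧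
      -- `(ι, h)` is a universal arrow from `ℋ` to the functor `Φ`
      Nonempty (Limits.IsInitial (StructuredArrow.mk h)) ∧
      -- the universal property spelled out, with the formula for `ψ`
      ∀ (P : PartialGroup.{u}) (φ : PartialGroup.Hom F P)
        (f : FPartialGroup.Hom H (FPartialGroup.conj φ)),
        ∃ ψ : PartialGroup.Hom (FPartialGroup.semidirect F H) P,
          (∀ γ : F, ψ (PartialGroup.Hom.toFun ι γ) = φ γ) ∧
          (∀ η : H, ψ ((FPartialGroup.Hom.hom h) η) = f η) ∧
          (∀ x : H.SemiElt, ψ x ∈ P.prod [φ x.1.1, f x.1.2]) ∧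
          ∀ ψ' : PartialGroup.Hom (FPartialGroup.semidirect F H) P,
            (∀ γ : F, ψ' (PartialGroup.Hom.toFun ι γ) = φ γ) →
            (∀ η : H, ψ' ((FPartialGroup.Hom.hom h) η) = f η) → ψ' = ψ := by
  refine ⟨H.inl, H.unit, fun _ => rfl, fun _ => rfl, ⟨H.isInitialUnit⟩, fun P φ f => ?_⟩
  exact ⟨FPartialGroup.lift f, FPartialGroup.lift_inl f, FPartialGroup.lift_inr f,
    FPartialGroup.liftFun_mem f, fun ψ h1 h2 => FPartialGroup.lift_unique f ψ h1 h2⟩
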